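/- Fix an integer $M\ge 1$. Equip the set $\{0,1,\ldots,M\}^{\mathbb N}$ of sequences $c=(c_i)_{i\ge 1}$ with the metric $\rho(c,d)=2^{-n}$ if $c_n\ne d_n$ and $c_i=d_i$ for all $i<n$ (and $\rho(c,c)=0$). For $q>1$, the sequence $(c_i)$ is an expansion of $x\in\mathbb R$ in base $q$ if $\sum_{i\ge1}c_iq^{-i}=x$. The quasi-greedy sequence $a(x,q)=(a_n)$ of $x>0$ is defined recursively: $a_n$ is the largest digit in $\{0,\ldots,M\}$ such that $\sum_{i\le n}a_iq^{-i}<x$; moreover $a(0,q)=000\cdots$. Put $\alpha(q)=a(1,q)$; in particular $\alpha(q)=MMM\cdots$ for $q\ge M+1$. For $q>1$ define: - $\mathcal U_q'$: the set of the sequences that are the unique expansion in base $q$ of some real number; - $\mathcal V_q'$: the set of the sequences $(a_n)=a(x,q)$, where $x\ge 0$ is such that $a(x,q)$ is an expansion of $x$ in base $q$ and, whenever $a_n>0$, the reflected tail $(M-a_{n+1})(M-a_{n+2})\cdots$ is lexicographically less than or equal to $\alpha(q)$. Let $q>1$, and let $(q_n)$ be a sequence of real numbers with $q_n>1$ for all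 $n$ and $q_n\to q$. Then, in the Hausdorff metric for sets of sequences: (i) if $q_n<q$ for all $n$ (in particular, if $q_n$ strictly increases to $q$), then $\mathcal U_{q_n}'\to\mathcal U_q'$ and $\mathcal V_{q_n}'\to\mathcal U_q'$; (ii) if $q_n>q$ for all $n$ (in particular, if $q_n$ strictly decreases to $q$), then $\mathcal U_{q_n}'\to\mathcal V_q'$ and $\mathcal V_{q_n}'\to\mathcal V_q'$. -/

import Mathlib

open Filter Topology

/-- A sequence over the alphabet `{0, 1, …, M}`. The digit `c.digit i` is the one that is
written `c_{i+1}` when digits are numbered from `1`. -/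
@[ext]
structure DigitSeq (M : ℕ) where
  digit : ℕ → Fin (M + 1)

namespace DigitSeq

variable {M : ℕ}

/-- The distance of two different sequences is `2⁻ⁿ`, where `n` is the position (counted from `1`)
of the first digit in which they differ. `PiNat.firstDiff` counts positions from `0`. -/
noncomputable def rho (c d : DigitSeq M) : ℝ :=
  open Classical in
  if c = d then 0
  else (1 / 2 : ℝ) ^ (PiNat.firstDiff (E := fun _ : ℕ => Fin (M + 1)) c.digit d.digit + 1)

theorem rho_self (c : DigitSeq M) : rho c c = 0 := by
  simp [rho]

theorem rho_comm (c d : DigitSeq M) : rho c d = rho d c := by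
  by_cases h : c = d
  · rw [h]
  · unfold rho
    rw [if_neg h, if_neg (Ne.symm h), PiNat.firstDiff_comm]

theorem rho_nonneg (c d : DigitSeq M) : 0 ≤ rho c d := by
  unfold rho
  split_ifs <;> positivity

theorem eq_of_rho_eq_zero (c d : DigitSeq M) (h : rho c d = 0) : c = d := by
  by_contra hne
  have : 0 < rho c d := by
    unfold rho
    rw [if_neg hne]
    positivity
  linarith

theorem rho_triangle (c d e : DigitSeq M) : rho c e ≤ rho c d + rho d e := by
  by_cases hce : c = e
  · rw [hce, rho_self]
    exact add_nonneg (rho_nonneg _ _) (rho_nonneg _ _)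
  by_cases hcd : c = d
  · rw [hcd, rho_self, zero_add]
  by_cases hde : d = e
  · rw [hde, rho_self, add_zero]
  have hmin := PiNat.min_firstDiff_le (E := fun _ : ℕ => Fin (M + 1)) c.digit d.digit e.digit
    (fun h => hce (DigitSeq.ext h))
  rcases min_le_iff.1 hmin with h | h
  · have : rho c e ≤ rho c d := by
      unfold rho
      rw [if_neg hce, if_neg hcd]
      exact pow_le_pow_of_le_one (by norm_num) (by norm_num) (by omega)
    linarith [rho_nonneg d e]
  · have : rho c e ≤ rho d e := by
      unfold rho
      rw [if_neg hce, if_neg hde]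
      exact pow_le_pow_of_le_one (by norm_num) (by norm_num) (by omega)
    linarith [rho_nonneg c d]

noncomputable instance : MetricSpace (DigitSeq M) where
  dist := rho
  dist_self := rho_self
  dist_comm := rho_comm
  dist_triangle := rho_triangle
  eq_of_dist_eq_zero := fun {c d} h => eq_of_rho_eq_zero c d h

/-- The number `(c)_q = ∑_{i ≥ 1} c_i / q^i`; the series converges for `q > 1`. -/
noncomputable def value (q : ℝ) (c : DigitSeq M) : ℝ :=
  ∑' i : ℕ, ((c.digit i : ℕ) : ℝ) / q ^ (i + 1)

/-- `c` is an expansion of `x` in base `q`. -/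
def IsExpansion (q : ℝ) (c : DigitSeq M) (x : ℝ) : Prop :=
  value q c = x

/-- The tail `c_{n+1} c_{n+2} …`, that is, `c` without its first `n` digits. -/
def tail (n : ℕ) (c : DigitSeq M) : DigitSeq M := ⟨fun i => c.digit (n + i)⟩

/-- The reflection `(M - c_i)`. -/
def reflection (c : DigitSeq M) : DigitSeq M := ⟨fun i => Fin.rev (c.digit i)⟩

/-- The lexicographic order `c ≤ d`. -/
def LexLE (c d : DigitSeq M) : Prop :=
  toLex c.digit ≤ toLex d.digit

end DigitSeq

/-- The largest digit `d ∈ {0, …, M}` with `d < y` (and `0` if there is none). -/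
noncomputable def quasiGreedyDigit (M : ℕ) (y : ℝ) : Fin (M + 1) :=
  ⟨min M (⌈y⌉₊ - 1), Nat.lt_succ_of_le (min_le_left _ _)⟩

/-- The rescaled remainder `q ^ n * (x - ∑_{i ≤ n} a_i / q ^ i)` after `n` steps of the
quasi-greedy algorithm. -/
noncomputable def quasiGreedyRem (M : ℕ) (q x : ℝ) : ℕ → ℝ
  | 0 => x
  | n + 1 => q * quasiGreedyRem M q x n -
      ((quasiGreedyDigit M (q * quasiGreedyRem M q x n) : ℕ) : ℝ)

/-- The quasi-greedy sequence `a(x, q)` of `x ≥ 0`: for `x > 0`, the digit `a_n` is the largest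
digit such that `a_1 / q + ⋯ + a_n / q ^ n < x`; for `x = 0` it is `0 0 0 …`. -/
noncomputable def quasiGreedy (M : ℕ) (q x : ℝ) : DigitSeq M :=
  ⟨fun n => quasiGreedyDigit M (q * quasiGreedyRem M q x n)⟩

/-- `α(q)`, the quasi-greedy expansion of `1` in base `q`; it is `M M M …` for `q ≥ M + 1`. -/
noncomputable def quasiGreedyOne (M : ℕ) (q : ℝ) : DigitSeq M := quasiGreedy M q 1

/-- `U_q`: the numbers with a unique expansion in base `q`. -/
def univoqueSet (M : ℕ) (q : ℝ) : Set ℝ :=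
  {x | ∃! c : DigitSeq M, c.IsExpansion q x}

/-- `U_q'`: the expansions of the numbers in `U_q`. -/
def univoqueSeqs (M : ℕ) (q : ℝ) : Set (DigitSeq M) :=
  {c | ∃ x ∈ univoqueSet M q, c.IsExpansion q x}

/-- `V_q`: the numbers `x` that have a quasi-greedy expansion `a = a(x, q)` and for which the
reflection of `a_{n+1} a_{n+2} …` is lexicographically at most `α(q)` whenever `a_n > 0`. -/
def vSet (M : ℕ) (q : ℝ) : Set ℝ :=
  {x | (quasiGreedy M q x).IsExpansion q x ∧
    ∀ n : ℕ, 0 < (quasiGreedy M q x).digit n →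
      ((quasiGreedy M q x).tail (n + 1)).reflection.LexLE (quasiGreedyOne M q)}

/-- `V_q'`: the quasi-greedy expansions of the numbers in `V_q`. -/
def vSeqs (M : ℕ) (q : ℝ) : Set (DigitSeq M) :=
  {c | ∃ x ∈ vSet M q, c = quasiGreedy M q x}

/-- Convergence of a sequence of sets to a set in the Hausdorff metric. -/
def HausdorffTendsto {X : Type*} [PseudoEMetricSpace X] (A : ℕ → Set X) (B : Set X) : Prop :=
  Tendsto (fun n => Metric.hausdorffEDist (A n) B) atTop (𝓝 0)

/-! Both families are described by values of tails. A sequence lies in `univoqueSeqs` exactly when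
every tail that follows a digit less than `M` has value less than 1, and the reflected sequence has
the same property (`univoqueSeqs_eq_strictSet`). For `q < M + 1` the set `vSeqs` is given by the
same conditions with `≤ 1` (`vSeqs_eq_weakSet`). The value of a nonzero sequence strictly decreases
in the base, so U_p' ⊆ V_p' ⊆ U_q' ⊆ V_q' for `p < q < M + 1`. Hausdorff convergence follows once
the sets eventually have the same prefixes of each length. There are finitely many words of a given
length, so by monotonicity each word can be treated separately.

From the right, weak inequalities are closed conditions, and by compactness a word that begins
elements of V_p' for all `p > q` begins an element of V_q' (`exists_base_weakSet_agree`).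

From the left, the sets U_p' with `p < q` must be dense in U_q'
(`exists_approximation_of_mem_strictSet`). If the relevant tails of `c` and of its reflection differ
from `α(q)` within a bounded number of digits, their values stay below `1 - ε`, and `c` itself lies
in some U_p'. Otherwise `c` or its reflection contains every prefix of `α(q)`. Then it is cut just
before such a prefix and continued by a periodic sequence whose period is a prefix of `α(q)` with
its last digit lowered by one (`exists_uniformly_below_approximation`).

For large bases, U_q' is everything when `q > M + 1`, and V_q' is dense when `q ≥ M + 1`. -/

namespace DigitSeq

variable {M : ℕ}

/-! ### Values of sequences and their dependence on the base -/

theorem digit_le (c : DigitSeq M) (n : ℕ) : (c.digit n : ℕ) ≤ M :=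
  Nat.lt_succ_iff.1 (c.digit n).2

theorem val_reflection_digit (c : DigitSeq M) (n : ℕ) :
    ((c.reflection.digit n : Fin (M + 1)) : ℕ) = M - c.digit n := by
  simp only [reflection, Fin.val_rev]
  omega

theorem reflection_reflection (c : DigitSeq M) : c.reflection.reflection = c := by
  ext n
  simp [reflection]

theorem reflection_tail (c : DigitSeq M) (n : ℕ) :
    (c.tail n).reflection = c.reflection.tail n := rfl

theorem tail_zero (c : DigitSeq M) : c.tail 0 = c := by
  ext n
  simp [tail]

theorem tail_tail (c : DigitSeq M) (m n : ℕ) : (c.tail m).tail n = c.tail (m + n) := by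
  ext i
  simp [tail, add_assoc]

theorem tail_digit (c : DigitSeq M) (m n : ℕ) : (c.tail m).digit n = c.digit (m + n) := rfl

theorem hasSum_inv_pow {q : ℝ} (hq : 1 < q) (K : ℝ) :
    HasSum (fun i : ℕ => K / q ^ (i + 1)) (K / (q - 1)) := by
  have h0 : (0 : ℝ) < q := by linarith
  have h := (hasSum_geometric_of_lt_one (inv_nonneg.2 h0.le) (inv_lt_one_of_one_lt₀ hq)).mul_left
    (K / q)
  have h1 : q - 1 ≠ 0 := by linarith
  have e1 : (fun i : ℕ => K / q ^ (i + 1)) = fun i : ℕ => K / q * q⁻¹ ^ i := by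
    funext i
    rw [inv_pow, pow_succ]
    field_simp
  have e2 : K / (q - 1) = K / q * (1 - q⁻¹)⁻¹ := by
    have e3 : 1 - q⁻¹ = (q - 1) / q := by field_simp
    rw [e3]
    field_simp
  rwa [e1, e2]

theorem summable_value {q : ℝ} (hq : 1 < q) (c : DigitSeq M) :
    Summable fun i : ℕ => ((c.digit i : ℕ) : ℝ) / q ^ (i + 1) := by
  have h0 : (0 : ℝ) < q := by linarith
  refine Summable.of_nonneg_of_le (fun i => by positivity) (fun i => ?_)
    (hasSum_inv_pow hq (M : ℝ)).summable
  have : ((c.digit i : ℕ) : ℝ) ≤ M := by exact_mod_cast c.digit_le i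
  gcongr

theorem mul_value {q : ℝ} (hq : 1 < q) (c : DigitSeq M) :
    q * value q c = (c.digit 0 : ℕ) + value q (c.tail 1) := by
  have h0 : q ≠ 0 := by linarith
  unfold value
  rw [(summable_value hq c).tsum_eq_zero_add, mul_add, ← tsum_mul_left]
  congr 1
  · simp
    field_simp
  · refine tsum_congr fun i => ?_
    rw [tail_digit, add_comm 1 i, pow_succ q (i + 1)]
    field_simp

theorem mul_value_tail {q : ℝ} (hq : 1 < q) (c : DigitSeq M) (n : ℕ) :
    q * value q (c.tail n) = (c.digit n : ℕ) + value q (c.tail (n + 1)) := by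
  rw [mul_value hq, tail_tail]
  rfl

theorem value_nonneg {q : ℝ} (hq : 1 < q) (c : DigitSeq M) : 0 ≤ value q c := by
  have h0 : (0 : ℝ) < q := by linarith
  exact tsum_nonneg fun i => by positivity

theorem value_add_value_reflection {q : ℝ} (hq : 1 < q) (c : DigitSeq M) :
    value q c + value q c.reflection = M / (q - 1) := by
  unfold value
  rw [← (summable_value hq c).tsum_add (summable_value hq c.reflection),
    ← (hasSum_inv_pow hq (M : ℝ)).tsum_eq]
  refine tsum_congr fun i => ?_
  rw [val_reflection_digit, Nat.cast_sub (c.digit_le i)]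
  ring

theorem value_le {q : ℝ} (hq : 1 < q) (c : DigitSeq M) : value q c ≤ M / (q - 1) := by
  linarith [value_add_value_reflection hq c, value_nonneg hq c.reflection]

theorem value_pos {q : ℝ} (hq : 1 < q) {c : DigitSeq M} {n : ℕ} (hn : 0 < (c.digit n : ℕ)) :
    0 < value q c := by
  have h0 : (0 : ℝ) < q := by linarith
  refine (summable_value hq c).tsum_pos (fun i => by positivity) n ?_
  have : (0 : ℝ) < (c.digit n : ℕ) := by exact_mod_cast hn
  positivity

theorem value_anti {p q : ℝ} (hp : 1 < p) (hpq : p ≤ q) (c : DigitSeq M) :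
    value q c ≤ value p c := by
  have h0 : (0 : ℝ) < p := by linarith
  refine (summable_value (hp.trans_le hpq) c).tsum_le_tsum (fun i => ?_) (summable_value hp c)
  gcongr

/-- Monotonicity applied to the reflection bounds the change of value by a quantity independent of
`c`. -/
theorem value_sub_le {p q : ℝ} (hp : 1 < p) (hpq : p ≤ q) (c : DigitSeq M) :
    value p c ≤ value q c + (M / (p - 1) - M / (q - 1)) := by
  linarith [value_anti hp hpq c.reflection, value_add_value_reflection hp c,
    value_add_value_reflection (hp.trans_le hpq) c]

theorem value_lt_of_lt {p q : ℝ} (hp : 1 < p) (hpq : p < q) {c : DigitSeq M} {n : ℕ}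
    (hn : 0 < (c.digit n : ℕ)) : value q c < value p c := by
  have h0 : (0 : ℝ) < p := by linarith
  have h1 : (0 : ℝ) < (c.digit n : ℕ) := by exact_mod_cast hn
  refine (summable_value (hp.trans hpq) c).tsum_lt_tsum (i := n) (fun i => ?_) ?_
    (summable_value hp c)
  · gcongr
  · gcongr

theorem value_lt_one_of_le_one {p q : ℝ} (hp : 1 < p) (hpq : p < q) {c : DigitSeq M}
    (h : value p c ≤ 1) : value q c < 1 := by
  by_cases hc : ∃ n, 0 < (c.digit n : ℕ)
  · obtain ⟨n, hn⟩ := hc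
    exact (value_lt_of_lt hp hpq hn).trans_le h
  · push Not at hc
    have : value q c = 0 := by
      unfold value
      simp [fun n => Nat.le_zero.1 (hc n)]
    linarith

/-- A bounded orbit of the maps `r ↦ q r - c_n` is the orbit of the values of the tails. -/
theorem value_tail_eq_of_bounded {q : ℝ} (hq : 1 < q) (c : DigitSeq M) (r : ℕ → ℝ) (C : ℝ)
    (hr : ∀ n, r (n + 1) = q * r n - (c.digit n : ℕ)) (hC : ∀ n, |r n| ≤ C) (n : ℕ) :
    value q (c.tail n) = r n := by
  by_contra hne
  have hstep : ∀ k, r (n + k) - value q (c.tail (n + k))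
      = q ^ k * (r n - value q (c.tail n)) := by
    intro k
    induction k with
    | zero => simp
    | succ k ih =>
      have h := mul_value_tail hq c (n + k)
      rw [← add_assoc, hr, pow_succ', mul_assoc, ← ih]
      linarith
  have hpos : 0 < |r n - value q (c.tail n)| :=
    abs_pos.2 (sub_ne_zero.2 (Ne.symm hne))
  obtain ⟨k, hk⟩ := pow_unbounded_of_one_lt
    ((C + M / (q - 1)) / |r n - value q (c.tail n)|) hq
  rw [div_lt_iff₀ hpos] at hk
  have h1 : |r (n + k) - value q (c.tail (n + k))| = q ^ k * |r n - value q (c.tail n)| := by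
    rw [hstep k, abs_mul, abs_of_pos (pow_pos (by linarith) k)]
  have h2 : |value q (c.tail (n + k))| ≤ M / (q - 1) := by
    rw [abs_of_nonneg (value_nonneg hq _)]
    exact value_le hq _
  have h3 := abs_sub (r (n + k)) (value q (c.tail (n + k)))
  linarith [hC (n + k)]

end DigitSeq

open DigitSeq

variable {M : ℕ}

/-! ### The quasi-greedy algorithm -/

theorem quasiGreedyDigit_lt {y : ℝ} (hy : 0 < y) : ((quasiGreedyDigit M y : ℕ) : ℝ) < y := by
  have h1 : (quasiGreedyDigit M y : ℕ) ≤ ⌈y⌉₊ - 1 := min_le_right _ _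
  have h2 : 0 < ⌈y⌉₊ := Nat.ceil_pos.2 hy
  have h3 : (quasiGreedyDigit M y : ℕ) < ⌈y⌉₊ := by omega
  exact Nat.lt_ceil.1 h3

theorem le_quasiGreedyDigit_add_one {y : ℝ} (h : (quasiGreedyDigit M y : ℕ) < M) :
    y ≤ (quasiGreedyDigit M y : ℕ) + 1 := by
  have h1 : (quasiGreedyDigit M y : ℕ) = min M (⌈y⌉₊ - 1) := rfl
  have h2 : ⌈y⌉₊ ≤ (quasiGreedyDigit M y : ℕ) + 1 := by omega
  have h3 : (⌈y⌉₊ : ℝ) ≤ (quasiGreedyDigit M y : ℕ) + 1 := by exact_mod_cast h2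
  exact (Nat.le_ceil y).trans h3

theorem quasiGreedyDigit_eq {y : ℝ} {d : ℕ} (hd : d ≤ M) (h1 : (d : ℝ) < y)
    (h2 : d < M → y ≤ d + 1) : (quasiGreedyDigit M y : ℕ) = d := by
  have h : (quasiGreedyDigit M y : ℕ) = min M (⌈y⌉₊ - 1) := rfl
  have h3 : d < ⌈y⌉₊ := Nat.lt_ceil.2 h1
  rcases hd.eq_or_lt with rfl | hlt
  · omega
  · have h4 : ⌈y⌉₊ ≤ d + 1 := Nat.ceil_le.2 (by exact_mod_cast h2 hlt)
    omega

theorem quasiGreedyRem_succ (q x : ℝ) (n : ℕ) : quasiGreedyRem M q x (n + 1) =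
    q * quasiGreedyRem M q x n - (((quasiGreedy M q x).digit n : ℕ) : ℝ) := rfl

theorem quasiGreedyRem_pos {q x : ℝ} (hq : 1 < q) (hx : 0 < x) (n : ℕ) :
    0 < quasiGreedyRem M q x n := by
  induction n with
  | zero => exact hx
  | succ n ih =>
    have := quasiGreedyDigit_lt (M := M) (y := q * quasiGreedyRem M q x n) (by nlinarith)
    exact sub_pos.2 this

theorem quasiGreedyRem_succ_le_one {q x : ℝ} {n : ℕ}
    (h : ((quasiGreedy M q x).digit n : ℕ) < M) : quasiGreedyRem M q x (n + 1) ≤ 1 := by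
  have := le_quasiGreedyDigit_add_one h
  rw [quasiGreedyRem_succ]
  simp only [quasiGreedy]
  linarith

/-- A digit less than `M` leaves a remainder at most 1, and the digit `M` maps `[0, K]` below `K`.
The choices used are `K = 1` and the fixed point `K = M / (q - 1)`. -/
theorem quasiGreedyRem_le {q x K : ℝ} (hq : 1 < q) (hK : 1 ≤ K) (hKM : q * K - M ≤ K) (hx : x ≤ K)
    (n : ℕ) : quasiGreedyRem M q x n ≤ K := by
  induction n with
  | zero => exact hx
  | succ n ih =>
    rcases ((quasiGreedy M q x).digit_le n).lt_or_eq with h | h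
    · exact (quasiGreedyRem_succ_le_one h).trans hK
    · rw [quasiGreedyRem_succ, h]
      nlinarith

theorem value_tail_quasiGreedy {q x K : ℝ} (hq : 1 < q) (hK : 1 ≤ K) (hKM : q * K - M ≤ K)
    (hx : 0 < x) (hxK : x ≤ K) (n : ℕ) :
    value q ((quasiGreedy M q x).tail n) = quasiGreedyRem M q x n :=
  value_tail_eq_of_bounded hq _ _ K (fun n => quasiGreedyRem_succ q x n)
    (fun n => by
      rw [abs_of_pos (quasiGreedyRem_pos hq hx n)]
      exact quasiGreedyRem_le hq hK hKM hxK n) n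

theorem exists_isExpansion {q x : ℝ} (hq : 1 < q) (hqM : q ≤ M + 1) (hx : 0 ≤ x)
    (hxM : x ≤ M / (q - 1)) : ∃ c : DigitSeq M, c.IsExpansion q x := by
  rcases hx.eq_or_lt with rfl | hx
  · exact ⟨⟨fun _ => 0⟩, by simp [IsExpansion, value]⟩
  · have h0 : 0 < q - 1 := by linarith
    refine ⟨quasiGreedy M q x, ?_⟩
    have := value_tail_quasiGreedy (M := M) hq (K := M / (q - 1))
      (by rw [le_div_iff₀ h0]; linarith) (le_of_eq (by field_simp; ring)) hx hxM 0
    rwa [tail_zero] at this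

theorem quasiGreedyRem_one_le_one {q : ℝ} (hq : 1 < q) (hqM : q ≤ M + 1) (n : ℕ) :
    quasiGreedyRem M q 1 n ≤ 1 :=
  quasiGreedyRem_le hq le_rfl (by linarith) le_rfl n

theorem value_tail_quasiGreedyOne {q : ℝ} (hq : 1 < q) (hqM : q ≤ M + 1) (n : ℕ) :
    value q ((quasiGreedyOne M q).tail n) = quasiGreedyRem M q 1 n :=
  value_tail_quasiGreedy hq le_rfl (by linarith) one_pos le_rfl n

theorem quasiGreedyOne_digit_of_le {q : ℝ} (hqM : M + 1 ≤ q) (n : ℕ) :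
    ((quasiGreedyOne M q).digit n : ℕ) = M := by
  have key : ∀ n, 1 ≤ quasiGreedyRem M q 1 n → ((quasiGreedyOne M q).digit n : ℕ) = M := by
    intro n hn
    refine quasiGreedyDigit_eq le_rfl ?_ (fun h => absurd h (lt_irrefl _))
    have : (0 : ℝ) ≤ M := Nat.cast_nonneg M
    nlinarith
  refine key n ?_
  induction n with
  | zero => exact le_rfl
  | succ n ih =>
    have h := key n ih
    have : (0 : ℝ) ≤ M := Nat.cast_nonneg M
    unfold quasiGreedyOne at h
    rw [quasiGreedyRem_succ, h]
    nlinarith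

/-! ### Lexicographic comparison within a bounded number of terms -/

/-- `a` precedes `b` lexicographically, and the first difference is among the first `m` terms. -/
def Below (m : ℕ) (a b : ℕ → ℕ) : Prop :=
  ∃ k < m, (∀ i < k, a i = b i) ∧ a k < b k

namespace Below

theorem mono {m n : ℕ} {a b : ℕ → ℕ} (h : Below m a b) (hmn : m ≤ n) : Below n a b := by
  obtain ⟨k, hk, h⟩ := h
  exact ⟨k, hk.trans_le hmn, h⟩

theorem congr {m : ℕ} {a b a' : ℕ → ℕ} (h : Below m a b) (ha : ∀ i < m, a' i = a i) :
    Below m a' b := by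
  obtain ⟨k, hk, h1, h2⟩ := h
  exact ⟨k, hk, fun i hi => (ha i (hi.trans hk)).trans (h1 i hi), by rwa [ha k hk]⟩

theorem not_symm {m n : ℕ} {a b : ℕ → ℕ} (h : Below m a b) : ¬ Below n b a := by
  rintro ⟨k, hk, h1, h2⟩
  obtain ⟨l, hl, h3, h4⟩ := h
  rcases lt_trichotomy k l with hkl | rfl | hkl
  · have := h3 k hkl
    omega
  · omega
  · have := h1 l hkl
    omega

theorem trichotomy (m : ℕ) (a b : ℕ → ℕ) :
    Below m a b ∨ (∀ i < m, a i = b i) ∨ Below m b a := by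
  induction m with
  | zero => exact Or.inr (Or.inl fun i hi => absurd hi (Nat.not_lt_zero i))
  | succ m ih =>
    rcases ih with h | h | h
    · exact Or.inl (h.mono (Nat.le_succ m))
    · rcases lt_trichotomy (a m) (b m) with hm | hm | hm
      · exact Or.inl ⟨m, Nat.lt_succ_self m, h, hm⟩
      · refine Or.inr (Or.inl fun i hi => ?_)
        rcases (Nat.lt_succ_iff_lt_or_eq.1 hi) with hi | rfl
        · exact h i hi
        · exact hm
      · exact Or.inr (Or.inr ⟨m, Nat.lt_succ_self m, fun i hi => (h i hi).symm, hm⟩)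
    · exact Or.inr (Or.inr (h.mono (Nat.le_succ m)))

theorem agree_of_not {m n : ℕ} {a b : ℕ → ℕ} (h : Below n a b) (hm : ¬ Below m a b) :
    ∀ i < m, a i = b i := by
  rcases trichotomy m a b with h1 | h1 | h1
  · exact absurd h1 hm
  · exact h1
  · exact absurd h1 h.not_symm

end Below

theorem exists_uniform_below {P : ℕ → Prop} {x : ℕ → ℕ → ℕ} {a : ℕ → ℕ}
    (h : ∀ n, P n → ∃ m, Below m (x n) a) (L : ℕ) :
    ∃ m, ∀ n < L, P n → Below m (x n) a := by
  choose! m hm using h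
  refine ⟨(Finset.range L).sup m, fun n hn hP => (hm n hP).mono ?_⟩
  exact Finset.le_sup (f := m) (Finset.mem_range.2 hn)

variable {a : ℕ → ℕ}

theorem pos_zero_of_tails (htail : ∀ k m, ¬ Below m a (fun i => a (k + i)))
    (hinf : ∀ n, ∃ i ≥ n, 0 < a i) : 0 < a 0 := by
  obtain ⟨i, -, hi⟩ := hinf 0
  by_contra h
  exact htail i 1 ⟨0, one_pos, by simp, by simp; omega⟩

/-- Arbitrarily far positions `N` at which no reflected factor of `a` that ends in `N` is a prefix
of `a`. -/
theorem exists_unmatched_position (htail : ∀ k m, ¬ Below m a (fun i => a (k + i)))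
    (hinf : ∀ n, ∃ i ≥ n, 0 < a i)
    (hrefl : ∀ k, 0 < a k → ∃ m, Below m (fun i => M - a (k + 1 + i)) a) (ha : ∀ i, a i ≤ M)
    (L : ℕ) : ∃ N ≥ L, 0 < a N ∧
      ∀ i < N, 0 < a i → Below (N - i) (fun s => M - a (i + 1 + s)) a := by
  classical
  obtain ⟨N, hNL, hN⟩ := hinf L
  by_cases hgood : ∃ i, i < N ∧ 0 < a i ∧ ¬ Below (N - i) (fun s => M - a (i + 1 + s)) a
  swap
  · push Not at hgood
    exact ⟨N, hNL, hN, hgood⟩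
  have hspec := Nat.find_spec hgood
  have hmin := fun j => Nat.find_min hgood (m := j)
  set i := Nat.find hgood
  obtain ⟨hiN, hi, hnot⟩ := hspec
  obtain ⟨m, k, -, h1, h2⟩ := hrefl i hi
  have hk : N - i ≤ k := by
    by_contra hk
    exact hnot ⟨k, by omega, h1, h2⟩
  -- The new position is where the reflected tail after the smallest bad `i` first drops below `a`.
  -- A bad `j < i` would contradict minimality, `j = i` has its mismatch exactly there, and a bad `j
  -- > i` would give a tail of `a` larger than `a`.
  refine ⟨i + 1 + k, by omega, ?_, ?_⟩
  · have := ha k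
    have h2' : M - a (i + 1 + k) < a k := h2
    omega
  intro j hj haj
  by_contra hb
  obtain ⟨m', hm'⟩ := hrefl j haj
  have hagree := hm'.agree_of_not hb
  rcases lt_trichotomy j i with hji | hji | hji
  · exact hmin j hji ⟨by omega, haj, fun hB => hb (hB.mono (by omega))⟩
  · have := hagree k (by omega)
    rw [hji] at this
    exact absurd this h2.ne
  · refine htail (j - i) (k - (j - i) + 1) ⟨k - (j - i), by omega, fun s hs => ?_, ?_⟩
    · have e1 := hagree s (by omega)
      have e2 := h1 (j - i + s) (by omega)
      have e3 : i + 1 + (j - i + s) = j + 1 + s := by omega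
      simp only [e3] at e1 e2
      simp only
      omega
    · have e1 := hagree (k - (j - i)) (by omega)
      have e2 : j + 1 + (k - (j - i)) = i + 1 + k := by omega
      have e3 : j - i + (k - (j - i)) = k := by omega
      simp only [e2] at e1
      simp only [e3]
      have h2' : M - a (i + 1 + k) < a k := h2
      omega

/-- The first digit already decides: `M - a 0 < a 0`. Otherwise the bounds on the tails and
reflected tails force `a` to be constantly `M / 2` up to the place where the reflected tail drops,
and the next digit would exceed `a 0`. -/
theorem below_reflection_self (htail : ∀ k m, ¬ Below m a (fun i => a (k + i)))
    (hinf : ∀ n, ∃ i ≥ n, 0 < a i)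
    (hrefl : ∀ k, 0 < a k → ∃ m, Below m (fun i => M - a (k + 1 + i)) a) (ha : ∀ i, a i ≤ M) :
    ∃ m, Below m (fun i => M - a i) a := by
  have h0 := pos_zero_of_tails htail hinf
  obtain ⟨m, k, -, h1, h2⟩ := hrefl 0 h0
  refine ⟨1, 0, one_pos, by simp, ?_⟩
  by_contra hcon
  simp only at hcon
  have hconst : ∀ n ≤ k, a n = a 0 ∧ M - a n = a 0 ∧ a (n + 1) ≤ a 0 := by
    intro n
    induction n using Nat.strong_induction_on with
    | _ n ih =>
      intro hn
      have hn1 : a n = a 0 ∧ M - a n = a 0 := by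
        rcases n with _ | n
        · have e1 : a 1 ≤ a 0 := by
            by_contra h
            exact htail 1 1 ⟨0, one_pos, by simp, by simp; omega⟩
          have e2 : M - a 1 ≤ a 0 := by
            rcases k.eq_zero_or_pos with rfl | hk
            · simpa using h2.le
            · simpa using (h1 0 hk).le
          have := ha 1
          have := ha 0
          omega
        · have e1 := (ih n (by omega) (by omega))
          have e2 := h1 n (by omega)
          have e3 : 0 + 1 + n = n + 1 := by omega
          simp only [e3] at e2
          have := ha (n + 1)
          have := (ih 0 (by omega) (by omega))
          omega
      refine ⟨hn1.1, hn1.2, ?_⟩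
      by_contra h
      refine htail 1 (n + 1) ⟨n, by omega, fun i hi => ?_, ?_⟩
      · have e1 := (ih i hi (by omega)).1
        have e2 : a (i + 1) = a 0 := by
          rcases (Nat.succ_le_of_lt hi).lt_or_eq with h' | h'
          · exact (ih (i + 1) h' (by omega)).1
          · rw [show i + 1 = n from h']
            exact hn1.1
        simp only [add_comm 1 i]
        omega
      · simp only [add_comm 1 n]
        omega
  have e1 := hconst k le_rfl
  have e3 : 0 + 1 + k = k + 1 := by omega
  simp only [e3] at h2
  have := ha (k + 1)
  omega

/-- A sequence that starts with a prefix of `a` and goes on with the reflection of a sequence that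
is close to `a`. -/
theorem Below.of_prefix_of_reflection {w k : ℕ} {x : ℕ → ℕ} (ha : ∀ i, a i ≤ M)
    (hx : ∀ i < w, x i = a i) (hk : Below k (fun i => M - a (w + i)) a)
    (hxk : ∀ i < k, x (w + i) = M - a i) : Below (w + k) x a := by
  obtain ⟨l, hl, h1, h2⟩ := hk
  refine ⟨w + l, by omega, fun i hi => ?_, ?_⟩
  · rcases lt_or_ge i w with hiw | hiw
    · exact hx i hiw
    · obtain ⟨s, rfl⟩ := Nat.exists_eq_add_of_le hiw
      have e1 := h1 s (by omega)
      have e2 := hxk s (by omega)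
      have := ha (w + s)
      simp only at e1
      omega
  · have e2 := hxk l hl
    have := ha (w + l)
    have := ha l
    simp only at h2
    omega

/-! ### The periodic sequence with a lowered last digit, and approximation by it -/

/-- The periodic sequence whose period is `a 0, …, a (N - 1), a N - 1`. -/
def decrementedPeriod (a : ℕ → ℕ) (N i : ℕ) : ℕ :=
  if i % (N + 1) = N then a N - 1 else a (i % (N + 1))

theorem decrementedPeriod_of_lt {N i : ℕ} (h : i < N) : decrementedPeriod a N i = a i := by
  have : i % (N + 1) = i := Nat.mod_eq_of_lt (by omega)
  rw [decrementedPeriod, this, if_neg h.ne]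

theorem decrementedPeriod_self {N : ℕ} : decrementedPeriod a N N = a N - 1 := by
  have : N % (N + 1) = N := Nat.mod_eq_of_lt (by omega)
  rw [decrementedPeriod, if_pos this]

theorem decrementedPeriod_add {N i : ℕ} (n : ℕ) :
    decrementedPeriod a N (n + i) = decrementedPeriod a N (n % (N + 1) + i) := by
  unfold decrementedPeriod
  simp

/-- If a factor of `a` ending before position `N` is a prefix of `a`, the digit `a N` is at most the
corresponding digit of `a`. Lowering it makes the comparison strict, so it is decided before the
period ends. -/
theorem below_decrementedPeriod (htail : ∀ k m, ¬ Below m a (fun i => a (k + i))) {N : ℕ}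
    (hN : 0 < a N) (n : ℕ) : Below (N + 1) (fun i => decrementedPeriod a N (n + i)) a := by
  simp only [decrementedPeriod_add n]
  have hj : n % (N + 1) < N + 1 := Nat.mod_lt _ (by omega)
  generalize n % (N + 1) = j at hj
  rcases Below.trichotomy (N - j) (fun i => a (j + i)) a with h | h | h
  · refine (h.congr fun i hi => ?_).mono (by omega)
    exact decrementedPeriod_of_lt (by omega)
  · refine ⟨N - j, by omega, fun i hi => ?_, ?_⟩
    · simp only
      rw [decrementedPeriod_of_lt (by omega)]
      exact h i hi
    · simp only
      have e : j + (N - j) = N := by omega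
      rw [e, decrementedPeriod_self]
      by_contra hlt
      refine htail j (N - j + 1) ⟨N - j, by omega, fun i hi => (h i hi).symm, ?_⟩
      simp only [e]
      omega
  · exact absurd h (htail j _)

/-- Lowering `a N` raises its reflection by one, which can destroy a strict inequality only at
position `N`. The reflected beginning of the next period then decides. -/
theorem below_reflection_decrementedPeriod {N m : ℕ} (ha : ∀ i, a i ≤ M) (hN : 0 < a N)
    (hgood : ∀ i < N, 0 < a i → Below (N - i) (fun s => M - a (i + 1 + s)) a)
    (hself : Below m (fun i => M - a i) a) (hmN : m ≤ N) (n : ℕ)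
    (hn : 0 < decrementedPeriod a N n) :
    Below (N + 1) (fun i => M - decrementedPeriod a N (n + 1 + i)) a := by
  have e0 : ∀ i, decrementedPeriod a N (n + 1 + i)
      = decrementedPeriod a N (n % (N + 1) + 1 + i) := fun i => by
    rw [add_assoc, decrementedPeriod_add, ← add_assoc]
  have e1 : decrementedPeriod a N n = decrementedPeriod a N (n % (N + 1)) :=
    decrementedPeriod_add (i := 0) n
  simp only [e0]
  rw [e1] at hn
  have hj : n % (N + 1) < N + 1 := Nat.mod_lt _ (by omega)
  generalize n % (N + 1) = j at hj hn
  rcases (Nat.lt_succ_iff.1 hj).lt_or_eq with hjN | rfl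
  · rw [decrementedPeriod_of_lt hjN] at hn
    obtain ⟨k, hk, h1, h2⟩ := hgood j hjN hn
    have hpre : ∀ i < k, M - decrementedPeriod a N (j + 1 + i) = a i := fun i hi => by
      rw [decrementedPeriod_of_lt (by omega)]
      exact h1 i hi
    rcases Nat.lt_or_ge (j + 1 + k) N with hkN | hkN
    · refine ⟨k, by omega, hpre, ?_⟩
      simp only
      rwa [decrementedPeriod_of_lt hkN]
    · have hk' : j + 1 + k = N := by omega
      simp only [hk'] at h2
      have haN := ha N
      have hend : M - decrementedPeriod a N (j + 1 + k) = M - a N + 1 := by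
        rw [hk', decrementedPeriod_self]
        omega
      rcases (Nat.succ_le_of_lt h2).lt_or_eq with h3 | h3
      · refine ⟨k, by omega, hpre, ?_⟩
        simp only [hend]
        exact h3
      -- The raised digit completes a prefix of `a` of length `k + 1`. The continuation is the
      -- reflection of `a`, so `hgood` at `k` gives a strict comparison within `k + 1 + (N - k) = N
      -- + 1` terms.
      · have hB := hgood k (by omega) (by omega)
        have := Below.of_prefix_of_reflection (w := k + 1)
          (x := fun i => M - decrementedPeriod a N (j + 1 + i)) ha (fun i hi => ?_) hB
          (fun i hi => ?_)
        · exact this.mono (by omega)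
        · rcases (Nat.lt_succ_iff.1 hi).lt_or_eq with hi | rfl
          · exact hpre i hi
          · simp only [hend]
            exact h3
        · have e2 : j + 1 + (k + 1 + i) = (N + 1) + i := by omega
          rw [e2, decrementedPeriod_add, Nat.mod_self, zero_add,
            decrementedPeriod_of_lt (by omega)]
  · have : ∀ i, decrementedPeriod a j (j + 1 + i) = decrementedPeriod a j i := fun i => by
      rw [decrementedPeriod_add, Nat.mod_self, zero_add]
    simp only [this]
    refine (hself.congr fun i hi => ?_).mono (by omega)
    rw [decrementedPeriod_of_lt (by omega)]

/-- If `c` contains all prefixes of `a`, then `c` is a limit of eventually periodic sequences all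
of whose admissible tails stay uniformly below `a`. -/
theorem exists_uniformly_below_approximation {c : ℕ → ℕ} (ha : ∀ i, a i ≤ M) (hc : ∀ i, c i ≤ M)
    (htail : ∀ k m, ¬ Below m a (fun i => a (k + i))) (hinf : ∀ n, ∃ i ≥ n, 0 < a i)
    (hup : ∀ n, c n < M → ∃ m, Below m (fun i => c (n + 1 + i)) a)
    (hlow : ∀ n, 0 < c n → ∃ m, Below m (fun i => M - c (n + 1 + i)) a)
    (hocc : ∀ m, ∃ n, c n < M ∧ ∀ i < m, c (n + 1 + i) = a i) (L : ℕ) :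
    ∃ d : ℕ → ℕ, (∀ i, d i ≤ M) ∧ (∀ i < L, d i = c i) ∧ ∃ B, ∀ n,
      (d n < M → Below B (fun i => d (n + 1 + i)) a) ∧
      (0 < d n → Below B (fun i => M - d (n + 1 + i)) a) := by
  classical
  -- This is inherited from `c`: an occurrence of `a 0, …, a k` in `c` continues below `a`, while
  -- the reflected tail of `c` after it is below `a`. The earlier of the two drops decides.
  have hrefl : ∀ k, 0 < a k → ∃ m, Below m (fun i => M - a (k + 1 + i)) a := by
    intro k hk
    obtain ⟨n, hn, hagree⟩ := hocc (k + 1)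
    obtain ⟨m1, l1, -, h1, h2⟩ := hup n hn
    have hl1 : k + 1 ≤ l1 := by
      by_contra h
      have := hagree l1 (by omega)
      simp only at h2
      omega
    obtain ⟨m2, l2, -, h3, h4⟩ := hlow (n + 1 + k) (by rw [hagree k (by omega)]; exact hk)
    obtain ⟨l, rfl⟩ := Nat.exists_eq_add_of_le hl1
    have ha1 := ha (k + 1 + l)
    have ha2 := ha (k + 1 + l2)
    have hshift : ∀ i, n + 1 + k + 1 + i = n + 1 + (k + 1 + i) := fun i => by omega
    simp only [hshift] at h3 h4
    simp only at h1 h2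
    rcases le_or_gt l l2 with hl | hl
    · refine ⟨l + 1, l, by omega, fun i hi => ?_, ?_⟩
      · simp only
        rw [← h1 (k + 1 + i) (by omega), h3 i (by omega)]
      · have : M - c (n + 1 + (k + 1 + l)) ≤ a l := by
          rcases hl.lt_or_eq with hl | rfl
          · exact (h3 l hl).le
          · exact h4.le
        simp only
        omega
    · refine ⟨l2 + 1, l2, by omega, fun i hi => ?_, ?_⟩
      · simp only
        rw [← h1 (k + 1 + i) (by omega), h3 i (by omega)]
      · simp only
        rw [← h1 (k + 1 + l2) (by omega)]
        exact h4
  -- No prefix of length `m₀` can occur after a position less than `L`, so the first occurrence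
  -- leaves the first `L` digits intact.
  obtain ⟨m₀, hm₀⟩ := exists_uniform_below hup L
  have hfirst := Nat.find_spec (hocc m₀)
  have hmin := fun j => Nat.find_min (hocc m₀) (m := j)
  set n := Nat.find (hocc m₀)
  obtain ⟨hnM, hagree⟩ := hfirst
  have hLn : L ≤ n := by
    by_contra h
    obtain ⟨k, hk, h1, h2⟩ := hm₀ n (by omega) hnM
    have := hagree k hk
    simp only at h2
    omega
  -- If the comparison were decided only after position `n`, then, as `n` is the first occurrence,
  -- it would be decided inside the copy of the prefix that starts at `n + 1`; a tail of `a` would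
  -- exceed `a`.
  have hupn : ∀ i < n, c i < M → Below (n - i) (fun s => c (i + 1 + s)) a := by
    intro i hi hiM
    by_contra hnot
    obtain ⟨m, k, hkm, h1, h2⟩ := hup i hiM
    have hk : n - i ≤ k := by
      by_contra hk
      exact hnot ⟨k, by omega, h1, h2⟩
    have hkm₀ : k < m₀ := by
      by_contra hk'
      exact hmin i hi ⟨hiM, fun s hs => h1 s (by omega)⟩
    refine htail (n - i) (k - (n - i) + 1) ⟨k - (n - i), by omega, fun s hs => ?_, ?_⟩
    · have e : n + 1 + s = i + 1 + (n - i + s) := by omega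
      rw [← hagree s (by omega), e]
      exact h1 (n - i + s) (by omega)
    · rw [← hagree (k - (n - i)) (by omega)]
      have e1 : n + 1 + (k - (n - i)) = i + 1 + k := by omega
      have e2 : n - i + (k - (n - i)) = k := by omega
      simp only [e1, e2]
      exact h2
  obtain ⟨m₁, hm₁⟩ := below_reflection_self htail hinf hrefl ha
  -- `m₂` serves the reflected tails of `d` that match `a` up to the cut; the period must be long
  -- enough to contain the comparison after it.
  obtain ⟨m₂, hm₂⟩ := exists_uniform_below hrefl n
  obtain ⟨N, hNL, hN, hgood⟩ := exists_unmatched_position htail hinf hrefl ha (max m₁ m₂)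
  have hm₁N : m₁ ≤ N := (le_max_left _ _).trans hNL
  have hm₂N : m₂ ≤ N := (le_max_right _ _).trans hNL
  set f := decrementedPeriod a N with hf
  set d : ℕ → ℕ := fun i => if i ≤ n then c i else f (i - (n + 1)) with hd
  have hdc : ∀ i ≤ n, d i = c i := fun i hi => if_pos hi
  have hdf : ∀ i, d (n + 1 + i) = f i := fun i => by
    simp only [hd]
    rw [if_neg (by omega)]
    congr 1
    omega
  have hfM : ∀ i, f i ≤ M := fun i => by
    rw [hf, decrementedPeriod]
    have h1 := ha N
    have h2 := ha (i % (N + 1))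
    split_ifs <;> omega
  refine ⟨d, fun i => ?_, fun i hi => hdc i (by omega), n + N + 1,
    fun i => ⟨fun hi => ?_, fun hi => ?_⟩⟩
  · simp only [hd]
    split_ifs
    · exact hc i
    · exact hfM _
  · rcases lt_or_ge i n with hin | hin
    · rw [hdc i hin.le] at hi
      exact ((hupn i hin hi).congr fun s hs => hdc _ (by omega)).mono (by omega)
    · obtain ⟨j, rfl⟩ := Nat.exists_eq_add_of_le hin
      have e : ∀ s, d (n + j + 1 + s) = f (j + s) := fun s => by
        rw [← hdf]
        congr 1
        omega
      simp only [e]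
      exact (below_decrementedPeriod htail hN j).mono (by omega)
  · rcases lt_trichotomy i n with hin | rfl | hin
    · rw [hdc i hin.le] at hi
      obtain ⟨m, hm⟩ := hlow i hi
      by_cases hB : Below (n - i) (fun s => M - c (i + 1 + s)) a
      · refine (hB.congr fun s hs => ?_).mono (by omega)
        rw [hdc _ (by omega)]
      · have hag := hm.agree_of_not hB
        -- The last matched digit is `M - c n`, which is positive because the cut follows a digit
        -- less than `M`.
        have hpos : 0 < a (n - i - 1) := by
          rw [← hag (n - i - 1) (by omega)]
          have e : i + 1 + (n - i - 1) = n := by omega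
          simp only [e]
          omega
        have hB' := hm₂ (n - i - 1) (by omega) hpos
        have e : n - i - 1 + 1 = n - i := by omega
        rw [e] at hB'
        refine (Below.of_prefix_of_reflection (w := n - i) ha (fun s hs => ?_) hB'
          fun s hs => ?_).mono (by omega)
        · rw [hdc _ (by omega)]
          exact hag s hs
        · have e : i + 1 + (n - i + s) = n + 1 + s := by omega
          rw [e, hdf, hf, decrementedPeriod_of_lt (by omega)]
    · simp only [hdf]
      refine (hm₁.congr fun s hs => ?_).mono (by omega)
      rw [hf, decrementedPeriod_of_lt (by omega)]
    · obtain ⟨j, rfl⟩ := Nat.exists_eq_add_of_le (Nat.succ_le_of_lt hin)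
      have e : ∀ s, d (n.succ + j + 1 + s) = f (j + 1 + s) := fun s => by
        rw [← hdf]
        congr 1
        omega
      simp only [e]
      rw [Nat.succ_eq_add_one, hdf] at hi
      exact (below_reflection_decrementedPeriod ha hN hgood hm₁ hm₁N j hi).mono (by omega)

/-! ### Value criteria for unique and quasi-greedy expansions -/

namespace DigitSeq

/-- The digits of a sequence as natural numbers. -/
def nat (c : DigitSeq M) (i : ℕ) : ℕ := c.digit i

/-- Every tail that follows a digit less than `M` has value at most `1`. -/
def TailsLE (q : ℝ) (c : DigitSeq M) : Prop :=
  ∀ n, c.nat n < M → value q (c.tail (n + 1)) ≤ 1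

/-- Every tail that follows a digit less than `M` has value less than `1`. -/
def TailsLT (q : ℝ) (c : DigitSeq M) : Prop :=
  ∀ n, c.nat n < M → value q (c.tail (n + 1)) < 1

/-- The sequences for which the value criterion holds weakly, together with its reflection. -/
def weakSet (M : ℕ) (q : ℝ) : Set (DigitSeq M) := {c | TailsLE q c ∧ TailsLE q c.reflection}

/-- The sequences for which the value criterion holds strictly, together with its reflection. -/
def strictSet (M : ℕ) (q : ℝ) : Set (DigitSeq M) := {c | TailsLT q c ∧ TailsLT q c.reflection}

theorem nat_reflection (c : DigitSeq M) (n : ℕ) : c.reflection.nat n = M - c.nat n :=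
  c.val_reflection_digit n

theorem nat_le (c : DigitSeq M) (n : ℕ) : c.nat n ≤ M := c.digit_le n

theorem nat_injective {c d : DigitSeq M} (h : ∀ n, c.nat n = d.nat n) : c = d := by
  ext n
  exact h n

theorem nat_reflection_lt {c : DigitSeq M} {n : ℕ} : c.reflection.nat n < M ↔ 0 < c.nat n := by
  have := c.nat_le n
  rw [nat_reflection]
  omega

theorem reflection_mem_strictSet {q : ℝ} {c : DigitSeq M} (h : c ∈ strictSet M q) :
    c.reflection ∈ strictSet M q :=
  ⟨h.2, by rw [reflection_reflection]; exact h.1⟩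

theorem TailsLE.tailsLT {p q : ℝ} (hp : 1 < p) (hpq : p < q) {c : DigitSeq M}
    (h : TailsLE p c) : TailsLT q c := fun n hn =>
  value_lt_one_of_le_one hp hpq (h n hn)

theorem weakSet_subset_strictSet {p q : ℝ} (hp : 1 < p) (hpq : p < q) :
    weakSet M p ⊆ strictSet M q := fun _ h => ⟨h.1.tailsLT hp hpq, h.2.tailsLT hp hpq⟩

theorem strictSet_subset_weakSet (q : ℝ) : strictSet M q ⊆ weakSet M q := fun _ h =>
  ⟨fun n hn => (h.1 n hn).le, fun n hn => (h.2 n hn).le⟩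

theorem value_lt_one_of_lt {q : ℝ} (hq : 1 < q) (hqM : M + 1 < q) (c : DigitSeq M) :
    value q c < 1 := by
  refine (value_le hq c).trans_lt ?_
  rw [div_lt_one (by linarith)]
  linarith

theorem strictSet_eq_univ {q : ℝ} (hq : 1 < q) (hqM : M + 1 < q) : strictSet M q = Set.univ :=
  Set.eq_univ_of_forall fun _ => ⟨fun _ _ => value_lt_one_of_lt hq hqM _,
    fun _ _ => value_lt_one_of_lt hq hqM _⟩

/-- The value criterion excludes two different expansions of the same number. -/
theorem not_lex_lt_of_tailsLT {q : ℝ} (hq : 1 < q) {c d : DigitSeq M} (hc : TailsLT q c)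
    (hcd : value q c = value q d) {k : ℕ} (hk : ∀ i < k, c.nat i = d.nat i) :
    ¬ c.nat k < d.nat k := by
  intro hlt
  have hagree : ∀ i ≤ k, value q (c.tail i) = value q (d.tail i) := by
    intro i
    induction i with
    | zero => intro _; rwa [tail_zero, tail_zero]
    | succ i ih =>
      intro hi
      have e1 := mul_value_tail hq c i
      have e2 := mul_value_tail hq d i
      have e3 : ((c.digit i : ℕ) : ℝ) = (d.digit i : ℕ) := by exact_mod_cast hk i (by omega)
      have e4 := ih (by omega)
      rw [e4] at e1
      linarith
  have e1 := mul_value_tail hq c k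
  have e2 := mul_value_tail hq d k
  rw [hagree k le_rfl] at e1
  have e3 : ((c.digit k : ℕ) : ℝ) + 1 ≤ (d.digit k : ℕ) := by exact_mod_cast hlt
  have e4 := hc k (hlt.trans_le (d.nat_le k))
  have e5 := value_nonneg hq (d.tail (k + 1))
  linarith

theorem exists_first_difference {c d : DigitSeq M} (h : c ≠ d) :
    ∃ k, (∀ i < k, c.nat i = d.nat i) ∧ c.nat k ≠ d.nat k := by
  classical
  have hex : ∃ k, c.nat k ≠ d.nat k := by
    by_contra hcon
    push Not at hcon
    exact h (nat_injective hcon)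
  exact ⟨Nat.find hex, fun i hi => not_not.1 (Nat.find_min hex hi), Nat.find_spec hex⟩

/-- A number with a tail of value at least `1` after a digit less than `M` has an expansion that is
larger at that digit. -/
theorem exists_ne_of_one_le_value_tail {q : ℝ} (hq : 1 < q) {c : DigitSeq M} {n : ℕ}
    (hn : c.nat n < M) (h : 1 ≤ value q (c.tail (n + 1))) :
    ∃ d, d ≠ c ∧ value q d = value q c := by
  have hqM : q ≤ M + 1 := by
    by_contra hlt
    exact absurd (value_lt_one_of_lt hq (not_le.1 hlt) _) (not_lt.2 h)
  -- Raising the digit at `n` by one is compensated by lowering the value of the tail by 1, which is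
  -- possible because that value is at least 1.
  obtain ⟨e, he⟩ := exists_isExpansion (M := M) hq hqM (x := value q (c.tail (n + 1)) - 1)
    (by linarith) (by linarith [value_le hq (c.tail (n + 1))])
  let d : DigitSeq M := ⟨fun i => if i < n then c.digit i else
    if i = n then ⟨c.nat n + 1, by omega⟩ else e.digit (i - (n + 1))⟩
  have hd : (d.digit n : ℕ) = c.nat n + 1 := by simp [d]
  have htail : d.tail (n + 1) = e := by
    ext i
    have h1 : ¬ n + 1 + i < n := by omega
    have h2 : n + 1 + i ≠ n := by omega
    simp [d, tail, h1, h2]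
  have key : ∀ j ≤ n, value q (d.tail (n - j)) = value q (c.tail (n - j)) := by
    intro j
    induction j with
    | zero =>
      intro _
      have e1 := mul_value_tail hq c n
      have e2 := mul_value_tail hq d n
      rw [htail, hd, he] at e2
      have e3 : ((c.digit n : ℕ) : ℝ) = c.nat n := rfl
      push_cast at e2
      rw [Nat.sub_zero]
      have : q ≠ 0 := by linarith
      refine mul_left_cancel₀ this ?_
      linarith
    | succ j ih =>
      intro hj
      have e1 := mul_value_tail hq c (n - (j + 1))
      have e2 := mul_value_tail hq d (n - (j + 1))
      have e3 : n - (j + 1) + 1 = n - j := by omega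
      have e4 : d.digit (n - (j + 1)) = c.digit (n - (j + 1)) := if_pos (by omega)
      rw [e3, ih (by omega), e4] at e2
      rw [e3] at e1
      have : q ≠ 0 := by linarith
      exact mul_left_cancel₀ this (by linarith)
  refine ⟨d, fun hdc => ?_, ?_⟩
  · rw [hdc] at hd
    exact absurd hd (Nat.lt_succ_self _).ne
  · have := key n le_rfl
    rwa [Nat.sub_self, tail_zero, tail_zero] at this

/-- A tail of value at least 1 allows its preceding digit to be raised, and reflection handles
lowering. Conversely, at the first difference of two expansions the one with the smaller digit needs
a tail of value at least 1. -/
theorem univoqueSeqs_eq_strictSet {q : ℝ} (hq : 1 < q) : univoqueSeqs M q = strictSet M q := by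
  ext c
  constructor
  · rintro ⟨x, ⟨e, -, he⟩, hc⟩
    have huniq : ∀ d : DigitSeq M, value q d = value q c → d = c := fun d hd =>
      (he d (hd.trans hc)).trans (he c hc).symm
    refine ⟨fun n hn => ?_, fun n hn => ?_⟩
    · by_contra h
      obtain ⟨d, hne, hd⟩ := exists_ne_of_one_le_value_tail hq hn (not_lt.1 h)
      exact hne (huniq d hd)
    · by_contra h
      obtain ⟨d, hne, hd⟩ := exists_ne_of_one_le_value_tail hq hn (not_lt.1 h)
      refine hne ?_
      rw [← reflection_reflection d]
      congr 1
      refine huniq _ ?_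
      have h1 := value_add_value_reflection hq c
      have h2 := value_add_value_reflection hq d
      linarith
  · rintro ⟨h1, h2⟩
    refine ⟨value q c, ⟨c, rfl, fun d hd => ?_⟩, rfl⟩
    by_contra hne
    obtain ⟨k, hk, hkne⟩ := exists_first_difference (Ne.symm hne)
    have hd' : value q c = value q d := Eq.symm hd
    rcases hkne.lt_or_gt with hlt | hlt
    · exact not_lex_lt_of_tailsLT hq h1 hd' hk hlt
    · refine not_lex_lt_of_tailsLT (d := d.reflection) (k := k) hq h2 ?_ (fun i hi => ?_) ?_
      · linarith [value_add_value_reflection hq c, value_add_value_reflection hq d]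
      · rw [nat_reflection, nat_reflection, hk i hi]
      · rw [nat_reflection, nat_reflection]
        have := c.nat_le k
        omega

theorem value_eq_zero_of_tail {q : ℝ} (hq : 1 < q) {c : DigitSeq M}
    (h : ∀ n, 0 < c.nat n → value q (c.tail (n + 1)) ≠ 0) {n : ℕ}
    (hn : value q (c.tail n) = 0) : value q c = 0 := by
  induction n with
  | zero => rwa [tail_zero] at hn
  | succ n ih =>
    refine ih ?_
    have h0 : c.nat n = 0 := by
      by_contra hne
      exact h n (Nat.pos_of_ne_zero hne) hn
    have e := mul_value_tail hq c n
    have h0' : ((c.digit n : ℕ) : ℝ) = 0 := congrArg Nat.cast h0 |>.trans Nat.cast_zero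
    rw [hn, h0', add_zero] at e
    exact (mul_eq_zero.1 e).resolve_left (by linarith)

theorem nat_eq_zero_of_value {q : ℝ} (hq : 1 < q) {c : DigitSeq M} (h : value q c = 0) (n : ℕ) :
    c.nat n = 0 := by
  by_contra hne
  exact (value_pos hq (Nat.pos_of_ne_zero hne)).ne' h

theorem value_eq_zero_of_nat {q : ℝ} {c : DigitSeq M} (h : ∀ n, c.nat n = 0) : value q c = 0 := by
  unfold value
  have : ∀ n, ((c.digit n : ℕ)) = 0 := h
  simp [this]

/-- In base less than `M + 1`, a sequence of the weak set is zero or has no zero tail. -/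
theorem tail_pos_or_zero_of_weak {q : ℝ} (hq : 1 < q) (hqM : q < M + 1) {c : DigitSeq M}
    (h : TailsLE q c.reflection) : (∀ n, 0 < value q (c.tail n)) ∨ ∀ n, c.nat n = 0 := by
  by_cases hz : ∃ n, value q (c.tail n) = 0
  · obtain ⟨n, hn⟩ := hz
    refine Or.inr (nat_eq_zero_of_value hq (value_eq_zero_of_tail hq (fun k hk h0 => ?_) hn))
    have e1 := h k (nat_reflection_lt.2 hk)
    have e2 := value_add_value_reflection hq (c.tail (k + 1))
    rw [h0, reflection_tail, zero_add] at e2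
    have e3 : 1 < M / (q - 1) := by
      rw [lt_div_iff₀ (by linarith)]
      linarith
    linarith
  · push Not at hz
    exact Or.inl fun n => lt_of_le_of_ne (value_nonneg hq _) (Ne.symm (hz n))

/-- The strict inequality admits the boundary base `q = M + 1`, where the reflection of a zero tail
has value exactly 1. -/
theorem tail_pos_or_zero_of_strict {q : ℝ} (hq : 1 < q) (hqM : q ≤ M + 1) {c : DigitSeq M}
    (h : TailsLT q c.reflection) : (∀ n, 0 < value q (c.tail n)) ∨ ∀ n, c.nat n = 0 := by
  by_cases hz : ∃ n, value q (c.tail n) = 0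
  · obtain ⟨n, hn⟩ := hz
    refine Or.inr (nat_eq_zero_of_value hq (value_eq_zero_of_tail hq (fun k hk h0 => ?_) hn))
    have e1 := h k (nat_reflection_lt.2 hk)
    have e2 := value_add_value_reflection hq (c.tail (k + 1))
    rw [h0, reflection_tail, zero_add] at e2
    have e3 : 1 ≤ M / (q - 1) := by
      rw [le_div_iff₀ (by linarith)]
      linarith
    linarith
  · push Not at hz
    exact Or.inl fun n => lt_of_le_of_ne (value_nonneg hq _) (Ne.symm (hz n))

/-- The quasi-greedy sequence is the only sequence without zero tails (or zero) whose tails after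
digits less than `M` have value at most `1`. -/
theorem quasiGreedy_value {q : ℝ} (hq : 1 < q) {c : DigitSeq M} (h : TailsLE q c)
    (hc : (∀ n, 0 < value q (c.tail n)) ∨ ∀ n, c.nat n = 0) :
    quasiGreedy M q (value q c) = c := by
  have step : ∀ n, quasiGreedyRem M q (value q c) n = value q (c.tail n) →
      (quasiGreedy M q (value q c)).nat n = c.nat n := by
    intro n hn
    change (quasiGreedyDigit M (q * quasiGreedyRem M q (value q c) n) : ℕ) = c.nat n
    -- In the nonzero case the scaled remainder is the digit plus a positive tail value, and this
    -- tail value is at most 1 if the digit is less than `M`; these are the conditions that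
    -- determine the quasi-greedy digit.
    rw [hn, mul_value_tail hq]
    rcases hc with hc | hc
    · refine quasiGreedyDigit_eq (c.nat_le n) ?_ fun hlt => ?_
      · have := hc (n + 1)
        have e : ((c.digit n : ℕ) : ℝ) = c.nat n := rfl
        linarith
      · have := h n hlt
        have e : ((c.digit n : ℕ) : ℝ) = c.nat n := rfl
        linarith
    · have e1 : value q (c.tail (n + 1)) = 0 := value_eq_zero_of_nat fun k => hc (n + 1 + k)
      have e2 : (c.digit n : ℕ) = 0 := hc n
      rw [e1, e2, hc n]
      simp [quasiGreedyDigit]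
  have hrem : ∀ n, quasiGreedyRem M q (value q c) n = value q (c.tail n) := by
    intro n
    induction n with
    | zero => rw [tail_zero]; rfl
    | succ n ih =>
      have e : (((quasiGreedy M q (value q c)).digit n : ℕ)) = (c.digit n : ℕ) := step n ih
      rw [quasiGreedyRem_succ, ih, e, mul_value_tail hq]
      ring
  exact nat_injective fun n => step n (hrem n)

theorem tailsLE_quasiGreedy {q x : ℝ} (hq : 1 < q)
    (h : (quasiGreedy M q x).IsExpansion q x) : TailsLE q (quasiGreedy M q x) := by
  intro n hn
  have hrem : ∀ n, value q ((quasiGreedy M q x).tail n) = quasiGreedyRem M q x n := by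
    intro n
    induction n with
    | zero => rw [tail_zero]; exact h
    | succ n ih =>
      have := mul_value_tail hq (quasiGreedy M q x) n
      rw [ih] at this
      rw [quasiGreedyRem_succ]
      linarith
  rw [hrem]
  exact quasiGreedyRem_succ_le_one hn

/-! ### Lexicographic comparison with `α(q)` and values -/

/-- Comparison of the value of a sequence with `1` through a common prefix with `α(q)`. -/
theorem quasiGreedyRem_sub_value_tail {q : ℝ} (hq : 1 < q) {e : DigitSeq M} {k : ℕ}
    (hk : ∀ i < k, e.nat i = (quasiGreedyOne M q).nat i) :
    quasiGreedyRem M q 1 k - value q (e.tail k) = q ^ k * (1 - value q e) := by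
  induction k with
  | zero => rw [tail_zero]; simp [quasiGreedyRem]
  | succ k ih =>
    have e1 := mul_value_tail hq e k
    have e2 : ((quasiGreedy M q 1).digit k : ℕ) = (e.digit k : ℕ) := (hk k (by omega)).symm
    rw [quasiGreedyRem_succ, e2, pow_succ', mul_assoc, ← ih fun i hi => hk i (by omega)]
    linarith

/-- A smaller digit loses at least one unit, so the positive remainder of `α(q)` survives as a gap.
The error `C` permits a bootstrap before the tail is known to have value at most 1. -/
theorem le_one_sub_value_of_below {q C : ℝ} (hq : 1 < q) {e : DigitSeq M} {k : ℕ}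
    (hk : ∀ i < k, e.nat i = (quasiGreedyOne M q).nat i)
    (hlt : e.nat k < (quasiGreedyOne M q).nat k) (hC : value q (e.tail (k + 1)) ≤ 1 + C) :
    quasiGreedyRem M q 1 (k + 1) - C ≤ q ^ (k + 1) * (1 - value q e) := by
  have e1 := mul_value_tail hq e k
  have e2 : ((e.digit k : ℕ) : ℝ) + 1 ≤ ((quasiGreedy M q 1).digit k : ℕ) := by
    exact_mod_cast hlt
  have e3 := quasiGreedyRem_sub_value_tail hq hk
  have e4 : q ^ (k + 1) * (1 - value q e)
      = q * quasiGreedyRem M q 1 k - q * value q (e.tail k) := by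
    rw [pow_succ', mul_assoc, ← e3]
    ring
  rw [quasiGreedyRem_succ]
  linarith

/-- The lexicographic criterion implies the value criterion. -/
theorem tailsLE_of_lex {q : ℝ} (hq : 1 < q) {c : DigitSeq M}
    (h : ∀ n, c.nat n < M → c.tail (n + 1) = quasiGreedyOne M q ∨
      ∃ m, Below m (c.tail (n + 1)).nat (quasiGreedyOne M q).nat) : TailsLE q c := by
  rcases lt_or_ge ((M : ℝ) + 1) q with hqM | hqM
  · exact fun n _ => (value_lt_one_of_lt hq hqM _).le
  have hq0 : 0 < q := by linarith
  -- Bootstrap: the tail after the first difference again follows a digit less than `M`, so each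
  -- round divides the possible excess over 1 by at least `q`.
  have hbound : ∀ j n, c.nat n < M →
      value q (c.tail (n + 1)) ≤ 1 + M / (q - 1) / q ^ j := by
    intro j
    induction j with
    | zero =>
      intro n _
      have := value_le hq (c.tail (n + 1))
      simp only [pow_zero, div_one]
      linarith
    | succ j ih =>
      intro n hn
      have hC : 0 ≤ (M : ℝ) / (q - 1) / q ^ j :=
        div_nonneg (div_nonneg (Nat.cast_nonneg M) (by linarith)) (by positivity)
      have hC' : (M : ℝ) / (q - 1) / q ^ (j + 1) = M / (q - 1) / q ^ j / q := by
        rw [pow_succ]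
        field_simp
      rw [hC']
      rcases h n hn with heq | ⟨m, k, -, h1, h2⟩
      · have := value_tail_quasiGreedyOne hq hqM 0
        rw [tail_zero] at this
        rw [heq, this]
        have : 0 ≤ (M : ℝ) / (q - 1) / q ^ j / q := by positivity
        simp only [quasiGreedyRem]
        linarith
      · have hk : c.nat (n + 1 + k) < M := h2.trans_le (nat_le _ k)
        have e1 := ih _ hk
        rw [add_assoc (n + 1), ← tail_tail] at e1
        have e2 := le_one_sub_value_of_below hq h1 h2 e1
        have e3 := quasiGreedyRem_pos (M := M) hq one_pos (k + 1)
        have e4 : q ≤ q ^ (k + 1) := by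
          calc q = q ^ 1 := (pow_one q).symm
            _ ≤ q ^ (k + 1) := pow_le_pow_right₀ hq.le (by omega)
        by_contra hcon
        push Not at hcon
        have e5 : (M : ℝ) / (q - 1) / q ^ j / q < value q (c.tail (n + 1)) - 1 := by linarith
        rw [div_lt_iff₀ hq0] at e5
        have e6 : 0 ≤ value q (c.tail (n + 1)) - 1 := by
          by_contra hneg
          nlinarith
        nlinarith
  intro n hn
  have hlim : Tendsto (fun j : ℕ => 1 + (M : ℝ) / (q - 1) / q ^ j) atTop (𝓝 (1 + 0)) :=
    (tendsto_const_nhds.div_atTop (tendsto_pow_atTop_atTop_of_one_lt hq)).const_add 1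
  rw [add_zero] at hlim
  exact ge_of_tendsto' hlim fun j => hbound j n hn

/-- A sequence without zero tails and of value at most `1` is not larger than `α(q)`. -/
theorem not_below_of_value_le_one {q : ℝ} (hq : 1 < q) {e : DigitSeq M}
    (he : (∀ n, 0 < value q (e.tail n)) ∨ ∀ n, e.nat n = 0) (h1 : value q e ≤ 1) (m : ℕ) :
    ¬ Below m (quasiGreedyOne M q).nat e.nat := by
  rintro ⟨k, -, hk, hlt⟩
  rcases he with he | he
  · have hk' : ∀ i < k, e.nat i = (quasiGreedyOne M q).nat i := fun i hi => (hk i hi).symm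
    have e1 := mul_value_tail hq e k
    have e3 := quasiGreedyRem_sub_value_tail hq hk'
    have e4 : 0 ≤ q ^ k * (1 - value q e) :=
      mul_nonneg (pow_nonneg (by linarith) k) (by linarith)
    have e5 := he (k + 1)
    have hM : (quasiGreedyOne M q).nat k < M := hlt.trans_le (e.nat_le k)
    have e6 := quasiGreedyRem_succ_le_one (M := M) hM
    have e2 : (((quasiGreedy M q 1).digit k : ℕ) : ℝ) + 1 ≤ (e.digit k : ℕ) := by
      exact_mod_cast hlt
    rw [quasiGreedyRem_succ] at e6
    -- With `r` the remainder of 1 after `k` steps, `q * r ≤ a_k + 1 ≤ e_k < q * value q (e.tail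
    -- k)`, while `e3` and `e4` give the opposite order.
    have hdig := le_quasiGreedyDigit_add_one (M := M) (y := q * quasiGreedyRem M q 1 k) hM
    have e7 : ((quasiGreedyDigit M (q * quasiGreedyRem M q 1 k) : ℕ) : ℝ)
      = ((quasiGreedy M q 1).digit k : ℕ) := rfl
    nlinarith
  · have := he k
    omega

theorem lexLE_iff (c d : DigitSeq M) : c.LexLE d ↔ c = d ∨ ∃ m, Below m c.nat d.nat := by
  unfold LexLE
  rw [le_iff_eq_or_lt]
  refine or_congr ⟨fun h => DigitSeq.ext (toLex.injective h), fun h => by rw [h]⟩ ⟨?_, ?_⟩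
  · rintro ⟨k, h1, h2⟩
    exact ⟨k + 1, k, Nat.lt_succ_self k, fun i hi => congrArg Fin.val (h1 i hi), h2⟩
  · rintro ⟨m, k, -, h1, h2⟩
    exact ⟨k, fun i hi => Fin.ext (h1 i hi), h2⟩

theorem eq_or_below_of_not {c d : DigitSeq M} (h : ∀ m, ¬ Below m d.nat c.nat) :
    c = d ∨ ∃ m, Below m c.nat d.nat := by
  by_cases hcd : c = d
  · exact Or.inl hcd
  · obtain ⟨k, hk, hne⟩ := exists_first_difference hcd
    rcases hne.lt_or_gt with hlt | hlt
    · exact Or.inr ⟨k + 1, k, Nat.lt_succ_self k, hk, hlt⟩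
    · exact absurd ⟨k, Nat.lt_succ_self k, fun i hi => (hk i hi).symm, hlt⟩ (h (k + 1))

theorem pos_or_zero_tail {q : ℝ} {c : DigitSeq M}
    (h : (∀ n, 0 < value q (c.tail n)) ∨ ∀ n, c.nat n = 0) (k : ℕ) :
    (∀ n, 0 < value q ((c.tail k).tail n)) ∨ ∀ n, (c.tail k).nat n = 0 := by
  rcases h with h | h
  · exact Or.inl fun n => by rw [tail_tail]; exact h _
  · exact Or.inr fun n => h (k + n)

/-- Lexicographic and value conditions are interchangeable for sequences without zero tails. For `q
< M + 1` a nonzero element of `weakSet` has none, since the reflection of a zero tail has value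
greater than 1. -/
theorem vSeqs_eq_weakSet {q : ℝ} (hq : 1 < q) (hqM : q < M + 1) : vSeqs M q = weakSet M q := by
  ext c
  constructor
  · rintro ⟨x, ⟨hx, hlex⟩, rfl⟩
    refine ⟨tailsLE_quasiGreedy hq hx, tailsLE_of_lex hq fun n hn => ?_⟩
    exact (lexLE_iff _ _).1 (hlex n (nat_reflection_lt.1 hn))
  · rintro ⟨h1, h2⟩
    have h2' : TailsLE q c.reflection.reflection := by rwa [reflection_reflection]
    have hc := quasiGreedy_value hq h1 (tail_pos_or_zero_of_weak hq hqM h2)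
    refine ⟨value q c, ⟨by rw [hc]; rfl, fun n hn => ?_⟩, hc.symm⟩
    rw [hc] at hn ⊢
    refine (lexLE_iff _ _).2 (eq_or_below_of_not fun m => ?_)
    rw [reflection_tail]
    exact not_below_of_value_le_one hq
      (pos_or_zero_tail (tail_pos_or_zero_of_weak hq hqM h2') _) (h2 n (nat_reflection_lt.2 hn)) m

/-- Here no value exceeds 1 and `α(q)` consists of digits `M`, so only the absence of zero tails
matters. -/
theorem mem_vSeqs_of_le {q : ℝ} (hq : 1 < q) (hqM : M + 1 ≤ q) {c : DigitSeq M}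
    (hc : ∀ n, ∃ i ≥ n, 0 < c.nat i) : c ∈ vSeqs M q := by
  have hle : ∀ e : DigitSeq M, value q e ≤ 1 := fun e => (value_le hq e).trans (by
    rw [div_le_one (by linarith)]
    linarith)
  have hpos : ∀ n, 0 < value q (c.tail n) := fun n => by
    obtain ⟨i, hi, hci⟩ := hc n
    obtain ⟨k, rfl⟩ := Nat.exists_eq_add_of_le hi
    exact value_pos hq (n := k) hci
  have h := quasiGreedy_value hq (fun n _ => hle _) (Or.inl hpos)
  refine ⟨value q c, ⟨by rw [h]; rfl, fun n _ => ?_⟩, h.symm⟩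
  rw [h]
  refine (lexLE_iff _ _).2 (eq_or_below_of_not fun m => ?_)
  rintro ⟨k, -, -, hlt⟩
  have e1 : (quasiGreedyOne M q).nat k = M := quasiGreedyOne_digit_of_le hqM k
  have e2 := nat_le ((c.tail (n + 1)).reflection) k
  omega

theorem below_of_mem_strictSet {q : ℝ} (hq : 1 < q) (hqM : q ≤ M + 1)
    {c : DigitSeq M} (hc : c ∈ strictSet M q) {n : ℕ} (hn : c.nat n < M) :
    ∃ m, Below m (c.tail (n + 1)).nat (quasiGreedyOne M q).nat := by
  have h1 := hc.1 n hn
  refine (eq_or_below_of_not fun m => not_below_of_value_le_one hq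
    (pos_or_zero_tail (tail_pos_or_zero_of_strict hq hqM hc.2) _) h1.le m).resolve_left fun h => ?_
  have e := value_tail_quasiGreedyOne hq hqM 0
  rw [tail_zero] at e
  rw [h, e] at h1
  exact lt_irrefl _ h1

theorem not_below_tail_quasiGreedyOne {q : ℝ} (hq : 1 < q) (hqM : q ≤ M + 1) (k m : ℕ) :
    ¬ Below m (quasiGreedyOne M q).nat ((quasiGreedyOne M q).tail k).nat := by
  refine not_below_of_value_le_one hq (Or.inl fun n => ?_) ?_ m
  · rw [tail_tail, value_tail_quasiGreedyOne hq hqM]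
    exact quasiGreedyRem_pos hq one_pos _
  · rw [value_tail_quasiGreedyOne hq hqM]
    exact quasiGreedyRem_one_le_one hq hqM k

theorem quasiGreedyOne_infinite {q : ℝ} (hq : 1 < q) (hqM : q ≤ M + 1) (n : ℕ) :
    ∃ i ≥ n, 0 < (quasiGreedyOne M q).nat i := by
  by_contra h
  push Not at h
  have e := value_tail_quasiGreedyOne hq hqM n
  have e2 := quasiGreedyRem_pos (M := M) hq one_pos n
  have : value q ((quasiGreedyOne M q).tail n) = 0 :=
    value_eq_zero_of_nat fun i => Nat.le_zero.1 (h (n + i) (by omega))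
  linarith

/-! ### Approximation from smaller bases -/

/-- If the tails stay uniformly below `α(q)`, then their values stay uniformly below `1`. -/
theorem exists_uniform_gap {q : ℝ} (hq : 1 < q) (m : ℕ) : ∃ ε > 0, ∀ c : DigitSeq M,
    (∀ n, c.nat n < M → Below m (c.tail (n + 1)).nat (quasiGreedyOne M q).nat) →
    ∀ n, c.nat n < M → value q (c.tail (n + 1)) ≤ 1 - ε := by
  -- Only finitely many places of first difference are possible, and each gives the positive gap
  -- `quasiGreedyRem M q 1 (k + 1) / q ^ (k + 1)`.
  have hgap : ∃ ε > 0, ∀ k < m, ε ≤ quasiGreedyRem M q 1 (k + 1) / q ^ (k + 1) := by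
    induction m with
    | zero => exact ⟨1, one_pos, fun k hk => absurd hk (Nat.not_lt_zero k)⟩
    | succ m ih =>
      obtain ⟨ε, hε, h⟩ := ih
      refine ⟨min ε (quasiGreedyRem M q 1 (m + 1) / q ^ (m + 1)), lt_min hε
        (div_pos (quasiGreedyRem_pos hq one_pos _) (pow_pos (by linarith) _)), fun k hk => ?_⟩
      rcases Nat.lt_succ_iff_lt_or_eq.1 hk with hk | rfl
      · exact (min_le_left _ _).trans (h k hk)
      · exact min_le_right _ _
  obtain ⟨ε, hε, h⟩ := hgap
  refine ⟨ε, hε, fun c hc n hn => ?_⟩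
  have hle : TailsLE q c := tailsLE_of_lex hq fun n hn => Or.inr ⟨m, hc n hn⟩
  obtain ⟨k, hk, h1, h2⟩ := hc n hn
  have hk' : c.nat (n + 1 + k) < M := h2.trans_le (nat_le _ k)
  have e1 := hle _ hk'
  rw [add_assoc (n + 1), ← tail_tail, ← add_zero (1 : ℝ)] at e1
  have e2 := le_one_sub_value_of_below hq h1 h2 e1
  have e3 := h k hk
  rw [le_div_iff₀ (pow_pos (by linarith) _)] at e3
  rw [sub_zero] at e2
  have e4 : ε * q ^ (k + 1) ≤ (1 - value q (c.tail (n + 1))) * q ^ (k + 1) := by linarith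
  have := le_of_mul_le_mul_right e4 (pow_pos (by linarith) _)
  linarith

theorem exists_base_lt {q : ℝ} (hq : 1 < q) {ε : ℝ} (hε : 0 < ε) :
    ∃ p, 1 < p ∧ p < q ∧ (M : ℝ) / (p - 1) - M / (q - 1) < ε := by
  have hcont : ContinuousAt (fun p : ℝ => (M : ℝ) / (p - 1) - M / (q - 1)) q := by
    have : q - 1 ≠ 0 := by linarith
    fun_prop (disch := assumption)
  have h1 : ∀ᶠ p in 𝓝 q, (M : ℝ) / (p - 1) - M / (q - 1) < ε := by
    refine hcont.eventually_lt continuousAt_const ?_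
    simpa using hε
  have h2 : ∀ᶠ p in 𝓝[<] q, 1 < p ∧ p < q ∧ (M : ℝ) / (p - 1) - M / (q - 1) < ε := by
    filter_upwards [nhdsWithin_le_nhds h1, nhdsWithin_le_nhds (lt_mem_nhds hq),
      self_mem_nhdsWithin] with p h3 h4 h5
    exact ⟨h4, h5, h3⟩
  exact h2.exists

/-- The uniform gap in base `q` absorbs the uniform increase of values in a slightly smaller base.
-/
theorem exists_mem_strictSet_of_uniform {q : ℝ} (hq : 1 < q) {c : DigitSeq M} {m : ℕ}
    (h1 : ∀ n, c.nat n < M → Below m (c.tail (n + 1)).nat (quasiGreedyOne M q).nat)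
    (h2 : ∀ n, c.reflection.nat n < M →
      Below m (c.reflection.tail (n + 1)).nat (quasiGreedyOne M q).nat) :
    ∃ p, 1 < p ∧ p < q ∧ c ∈ strictSet M p := by
  obtain ⟨ε, hε, h⟩ := exists_uniform_gap (M := M) hq m
  obtain ⟨p, hp, hpq, hlt⟩ := exists_base_lt (M := M) hq hε
  refine ⟨p, hp, hpq, fun n hn => ?_, fun n hn => ?_⟩
  · linarith [value_sub_le hp hpq.le (c.tail (n + 1)), h _ h1 n hn]
  · linarith [value_sub_le hp hpq.le (c.reflection.tail (n + 1)), h _ h2 n hn]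

theorem exists_mem_strictSet_of_prefixes {q : ℝ} (hq : 1 < q) (hqM : q ≤ M + 1)
    {c : DigitSeq M} (hc : c ∈ strictSet M q)
    (hocc : ∀ m, ∃ n, c.nat n < M ∧ ∀ i < m, c.nat (n + 1 + i) = (quasiGreedyOne M q).nat i)
    (L : ℕ) : ∃ p, 1 < p ∧ p < q ∧ ∃ d ∈ strictSet M p, ∀ i < L, d.nat i = c.nat i := by
  have hrefl : ∀ (e : DigitSeq M) n, (e.reflection.tail n).nat = fun i => M - e.nat (n + i) :=
    fun e n => funext fun i => nat_reflection e (n + i)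
  obtain ⟨d, hdM, hdL, B, hB⟩ := exists_uniformly_below_approximation (M := M)
    (a := (quasiGreedyOne M q).nat) (c := c.nat) (nat_le _) (nat_le _)
    (not_below_tail_quasiGreedyOne hq hqM) (quasiGreedyOne_infinite hq hqM)
    (fun n hn => below_of_mem_strictSet hq hqM hc hn)
    (fun n hn => by
      have := below_of_mem_strictSet hq hqM (reflection_mem_strictSet hc)
        (nat_reflection_lt.2 hn)
      rwa [hrefl] at this) hocc L
  let d' : DigitSeq M := ⟨fun i => ⟨d i, Nat.lt_succ_of_le (hdM i)⟩⟩
  obtain ⟨p, hp, hpq, h⟩ := exists_mem_strictSet_of_uniform (c := d') hq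
    (fun n hn => (hB n).1 hn) (fun n hn => by
      rw [hrefl]
      exact (hB n).2 (nat_reflection_lt.1 hn))
  exact ⟨p, hp, hpq, d', h, hdL⟩

/-- The sets `U_p'` with `p < q` are jointly dense in `U_q'`. -/
theorem exists_approximation_of_mem_strictSet {q : ℝ} (hq : 1 < q)
    (hqM : q ≤ M + 1) {c : DigitSeq M} (hc : c ∈ strictSet M q) (L : ℕ) :
    ∃ p, 1 < p ∧ p < q ∧ ∃ d ∈ strictSet M p, ∀ i < L, d.nat i = c.nat i := by
  have hocc : ∀ e ∈ strictSet M q,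
      (∃ m, ∀ n, e.nat n < M → Below m (e.tail (n + 1)).nat (quasiGreedyOne M q).nat) ∨
      ∀ m, ∃ n, e.nat n < M ∧ ∀ i < m, e.nat (n + 1 + i) = (quasiGreedyOne M q).nat i := by
    intro e he
    refine or_iff_not_imp_left.2 fun h m => ?_
    push Not at h
    obtain ⟨n, hn, hnot⟩ := h m
    obtain ⟨m', hm'⟩ := below_of_mem_strictSet hq hqM he hn
    exact ⟨n, hn, hm'.agree_of_not hnot⟩
  have hc' := reflection_mem_strictSet hc
  rcases hocc c hc with ⟨m₁, h1⟩ | h1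
  · rcases hocc _ hc' with ⟨m₂, h2⟩ | h2
    · obtain ⟨p, hp, hpq, h⟩ := exists_mem_strictSet_of_uniform (c := c) (m := max m₁ m₂) hq
        (fun n hn => (h1 n hn).mono (le_max_left _ _))
        (fun n hn => (h2 n hn).mono (le_max_right _ _))
      exact ⟨p, hp, hpq, c, h, fun _ _ => rfl⟩
    · obtain ⟨p, hp, hpq, d, hd, hag⟩ := exists_mem_strictSet_of_prefixes hq hqM hc' h2 L
      refine ⟨p, hp, hpq, d.reflection, reflection_mem_strictSet hd, fun i hi => ?_⟩
      have e1 := hag i hi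
      have e2 := c.nat_le i
      rw [nat_reflection] at e1 ⊢
      omega
  · exact exists_mem_strictSet_of_prefixes hq hqM hc h1 L

end DigitSeq

/-! ### Prefixes, compactness and Hausdorff convergence -/

namespace DigitSeq

theorem dist_le_of_agree {c d : DigitSeq M} {m : ℕ} (h : ∀ i < m, c.nat i = d.nat i) :
    dist c d ≤ (1 / 2 : ℝ) ^ m := by
  change rho c d ≤ _
  unfold rho
  split_ifs with hcd
  · positivity
  · refine pow_le_pow_of_le_one (by norm_num) (by norm_num) ?_
    have hne : c.digit ≠ d.digit := fun h => hcd (DigitSeq.ext h)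
    by_contra hlt
    exact PiNat.apply_firstDiff_ne hne (Fin.ext (h _ (by omega)))

/-- Sets of sequences converge if they eventually have the same prefixes of any given length. -/
theorem hausdorffTendsto_of_agree {A : ℕ → Set (DigitSeq M)} {B : Set (DigitSeq M)}
    (h : ∀ m, ∀ᶠ n in atTop, (∀ c ∈ A n, ∃ d ∈ B, ∀ i < m, c.nat i = d.nat i) ∧
      ∀ d ∈ B, ∃ c ∈ A n, ∀ i < m, d.nat i = c.nat i) : HausdorffTendsto A B := by
  refine ENNReal.tendsto_nhds_zero.2 fun ε hε => ?_
  obtain ⟨δ, hδ0, hδε⟩ : ∃ δ : ℝ, 0 < δ ∧ ENNReal.ofReal δ ≤ ε := by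
    obtain ⟨r, -, hr0, hr⟩ := ENNReal.lt_iff_exists_real_btwn.1 hε
    exact ⟨r, by simpa using hr0, hr.le⟩
  obtain ⟨m, hm⟩ := exists_pow_lt_of_lt_one hδ0 (show (1 / 2 : ℝ) < 1 by norm_num)
  have hedist : ∀ c d : DigitSeq M, (∀ i < m, c.nat i = d.nat i) → edist c d ≤ ε := by
    intro c d hcd
    rw [edist_dist]
    exact (ENNReal.ofReal_le_ofReal ((dist_le_of_agree hcd).trans hm.le)).trans hδε
  filter_upwards [h m] with n hn
  refine Metric.hausdorffEDist_le_of_mem_edist (fun c hc => ?_) fun d hd => ?_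
  · obtain ⟨d, hd, hcd⟩ := hn.1 c hc
    exact ⟨d, hd, hedist _ _ hcd⟩
  · obtain ⟨c, hc, hcd⟩ := hn.2 d hd
    exact ⟨c, hc, hedist _ _ hcd⟩

/-- The first `m` digits. -/
def initial (m : ℕ) (c : DigitSeq M) : Fin m → Fin (M + 1) := fun i => c.digit i

theorem initial_eq_iff {m : ℕ} {c d : DigitSeq M} :
    c.initial m = d.initial m ↔ ∀ i < m, c.nat i = d.nat i :=
  ⟨fun h i hi => congrArg Fin.val (congrFun h ⟨i, hi⟩), fun h => funext fun i => Fin.ext (h i i.2)⟩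

theorem strictSet_mono_base {p q : ℝ} (hp : 1 < p) (hpq : p < q) :
    strictSet M p ⊆ strictSet M q :=
  (strictSet_subset_weakSet p).trans (weakSet_subset_strictSet hp hpq)

theorem weakSet_mono_base {p q : ℝ} (hp : 1 < p) (hpq : p ≤ q) : weakSet M p ⊆ weakSet M q := by
  rcases hpq.eq_or_lt with rfl | hpq
  · exact subset_rfl
  · exact (weakSet_subset_strictSet hp hpq).trans (strictSet_subset_weakSet q)

/-- Each of the finitely many words of length `m` has its own base; monotonicity lets the largest of
them serve all. -/
theorem exists_base_strictSet_agree {q : ℝ} (hq : 1 < q) (hqM : q ≤ M + 1) (m : ℕ) :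
    ∃ p < q, ∀ r, p < r → r < q → ∀ c ∈ strictSet M q, ∃ d ∈ strictSet M r,
      ∀ i < m, c.nat i = d.nat i := by
  have hword : ∀ w : Fin m → Fin (M + 1), ∃ p, 1 < p ∧ p < q ∧
      ∀ c ∈ strictSet M q, c.initial m = w → ∃ d ∈ strictSet M p, d.initial m = w := by
    intro w
    by_cases hw : ∃ c ∈ strictSet M q, c.initial m = w
    · obtain ⟨c, hc, hcw⟩ := hw
      obtain ⟨p, hp, hpq, d, hd, hdc⟩ := exists_approximation_of_mem_strictSet hq hqM hc m
      exact ⟨p, hp, hpq, fun _ _ _ => ⟨d, hd, (initial_eq_iff.2 hdc).trans hcw⟩⟩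
    · obtain ⟨p, hp, hpq⟩ := exists_between hq
      exact ⟨p, hp, hpq, fun c hc hcw => absurd ⟨c, hc, hcw⟩ hw⟩
  choose p hp hpq h using hword
  refine ⟨Finset.univ.sup' Finset.univ_nonempty p,
    (Finset.sup'_lt_iff _).2 fun w _ => hpq w, fun r hr _ c hc => ?_⟩
  obtain ⟨d, hd, hdw⟩ := h (c.initial m) c hc rfl
  refine ⟨d, strictSet_mono_base (hp _) (lt_of_le_of_lt ?_ hr) hd, initial_eq_iff.1 hdw.symm⟩
  exact Finset.le_sup' p (Finset.mem_univ _)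

theorem continuous_value {q : ℝ} (hq : 1 < q) :
    Continuous fun f : ℕ → Fin (M + 1) => value q ⟨f⟩ := by
  have h0 : (0 : ℝ) < q := by linarith
  unfold value
  refine continuous_tsum (fun i => ?_) (hasSum_inv_pow hq (M : ℝ)).summable fun i f => ?_
  · exact ((continuous_of_discreteTopology (f := fun d : Fin (M + 1) => ((d : ℕ) : ℝ))).comp
      (continuous_apply i)).div_const _
  · rw [Real.norm_of_nonneg (by positivity)]
    have : ((f i : ℕ) : ℝ) ≤ M := by exact_mod_cast Nat.lt_succ_iff.1 (f i).2
    gcongr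

theorem isClosed_tailsLE {q : ℝ} (hq : 1 < q) :
    IsClosed {f : ℕ → Fin (M + 1) | TailsLE q ⟨f⟩} := by
  simp only [TailsLE, Set.ofPred_forall]
  refine isClosed_iInter fun n => ?_
  refine isClosed_imp ?_ ?_
  · exact (isOpen_discrete {d : Fin (M + 1) | (d : ℕ) < M}).preimage
      (continuous_apply (A := fun _ : ℕ => Fin (M + 1)) n)
  · refine isClosed_le ?_ continuous_const
    exact (continuous_value hq).comp (continuous_pi fun i => continuous_apply (n + 1 + i))

theorem isClosed_weakSet {q : ℝ} (hq : 1 < q) :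
    IsClosed {f : ℕ → Fin (M + 1) | (⟨f⟩ : DigitSeq M) ∈ weakSet M q} := by
  refine (isClosed_tailsLE hq).inter ((isClosed_tailsLE hq).preimage
    (f := fun (f : ℕ → Fin (M + 1)) i => Fin.rev (f i)) (continuous_pi fun i => ?_))
  exact (continuous_of_discreteTopology (f := Fin.rev (n := M + 1))).comp
    (continuous_apply (A := fun _ : ℕ => Fin (M + 1)) i)

theorem mem_weakSet_of_forall_gt {q : ℝ} (hq : 1 < q) {c : DigitSeq M} {p : ℕ → ℝ}
    (hp : ∀ n, q ≤ p n) (hlim : Tendsto p atTop (𝓝 q)) (h : ∀ n, c ∈ weakSet M (p n)) :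
    c ∈ weakSet M q := by
  have key : ∀ e : DigitSeq M, (∀ n, value (p n) e ≤ 1) → value q e ≤ 1 := by
    intro e he
    have hq1 : q - 1 ≠ 0 := by linarith
    have h1 : Tendsto (fun n => (1 : ℝ) + (M / (q - 1) - M / (p n - 1))) atTop
        (𝓝 (1 + (M / (q - 1) - M / (q - 1)))) :=
      (((tendsto_const_nhds.div (hlim.sub_const 1) hq1)).const_sub _).const_add _
    rw [sub_self, add_zero] at h1
    exact ge_of_tendsto' h1 fun n => by linarith [value_sub_le hq (hp n) e, he n]
  exact ⟨fun k hk => key _ fun n => (h n).1 k hk, fun k hk => key _ fun n => (h n).2 k hk⟩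

/-- Upper semicontinuity of the weak sets from the right. -/
theorem exists_base_weakSet_agree {q : ℝ} (hq : 1 < q) (m : ℕ) :
    ∃ p > q, ∀ r, q < r → r < p → ∀ c ∈ weakSet M r, ∃ d ∈ weakSet M q,
      ∀ i < m, c.nat i = d.nat i := by
  have hword : ∀ w : Fin m → Fin (M + 1), ∃ p, q < p ∧
      ∀ c ∈ weakSet M p, c.initial m = w → ∃ d ∈ weakSet M q, d.initial m = w := by
    intro w
    by_contra hcon
    push Not at hcon
    let p : ℕ → ℝ := fun n => q + 1 / ((n : ℝ) + 1)
    have hp : ∀ n, q < p n := fun n => lt_add_of_pos_right q Nat.one_div_pos_of_nat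
    have hlim : Tendsto p atTop (𝓝 q) := by
      simpa [p] using (tendsto_one_div_add_atTop_nhds_zero_nat (𝕜 := ℝ)).const_add q
    have hclosed : ∀ n, IsClosed {f : ℕ → Fin (M + 1) |
        (⟨f⟩ : DigitSeq M) ∈ weakSet M (p n) ∧ (⟨f⟩ : DigitSeq M).initial m = w} := fun n => by
      refine (isClosed_weakSet (hq.trans (hp n))).inter ?_
      refine isClosed_eq ?_ continuous_const
      exact continuous_pi fun i => continuous_apply (i : ℕ)
    -- If `w` begins elements of the weak sets for all bases `p n` decreasing to `q`, these nested
    -- nonempty closed sets in the compact product space have a common point, which lies in the weak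
    -- set for `q`.
    obtain ⟨f, hf⟩ := IsCompact.nonempty_iInter_of_sequence_nonempty_isCompact_isClosed
      (fun n => {f : ℕ → Fin (M + 1) |
        (⟨f⟩ : DigitSeq M) ∈ weakSet M (p n) ∧ (⟨f⟩ : DigitSeq M).initial m = w})
      (fun n f hf => ⟨weakSet_mono_base (hq.trans (hp _)) (by
        simp only [p]
        gcongr
        simp) hf.1, hf.2⟩)
      (fun n => by
        obtain ⟨c, hc, hcw, -⟩ := hcon (p n) (hp n)
        exact ⟨c.digit, hc, hcw⟩)
      (hclosed 0).isCompact hclosed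
    simp only [Set.mem_iInter, Set.mem_ofPred_eq] at hf
    obtain ⟨c, hc, hcw, hnone⟩ := hcon (p 0) (hp 0)
    exact hnone ⟨f⟩ (mem_weakSet_of_forall_gt hq (fun n => (hp n).le) hlim fun n => (hf n).1)
      (hf 0).2
  choose p hp h using hword
  refine ⟨Finset.univ.inf' Finset.univ_nonempty p,
    (Finset.lt_inf'_iff _).2 fun w _ => hp w, fun r hr hrp c hc => ?_⟩
  have hrw : r ≤ p (c.initial m) := hrp.le.trans (Finset.inf'_le p (Finset.mem_univ _))
  obtain ⟨d, hd, hdw⟩ := h (c.initial m) c (weakSet_mono_base (hq.trans hr) hrw hc) rfl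
  exact ⟨d, hd, initial_eq_iff.1 hdw.symm⟩

/-- Padding a prefix with digits `M`, nonzero because `1 ≤ M`, avoids zero tails. -/
theorem exists_mem_vSeqs_agree (hM : 1 ≤ M) {q : ℝ} (hq : 1 < q) (hqM : M + 1 ≤ q)
    (c : DigitSeq M) (m : ℕ) : ∃ d ∈ vSeqs M q, ∀ i < m, c.nat i = d.nat i := by
  let d : DigitSeq M := ⟨fun i => if i < m then c.digit i else Fin.last M⟩
  refine ⟨d, mem_vSeqs_of_le hq hqM fun n => ⟨n + m, by omega, ?_⟩, fun i hi => ?_⟩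
  · have : d.digit (n + m) = Fin.last M := if_neg (by omega)
    unfold nat
    rw [this]
    exact hM
  · exact congrArg Fin.val (if_pos hi : d.digit i = c.digit i).symm

end DigitSeq

theorem corollary5 (M : ℕ) (hM : 1 ≤ M) (q : ℝ) (hq : 1 < q)
    (u : ℕ → ℝ) (hu : ∀ n, 1 < u n) (hlim : Tendsto u atTop (𝓝 q)) :
    ((∀ n, u n < q) →
      HausdorffTendsto (fun n => univoqueSeqs M (u n)) (univoqueSeqs M q) ∧
      HausdorffTendsto (fun n => vSeqs M (u n)) (univoqueSeqs M q)) ∧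
    ((∀ n, q < u n) →
      HausdorffTendsto (fun n => univoqueSeqs M (u n)) (vSeqs M q) ∧
      HausdorffTendsto (fun n => vSeqs M (u n)) (vSeqs M q)) := by
  simp only [univoqueSeqs_eq_strictSet, hu, hq]
  constructor
  · intro hlt
    rcases le_or_gt q (M + 1) with hqM | hqM
    · have hv : ∀ n, vSeqs M (u n) = weakSet M (u n) := fun n =>
        vSeqs_eq_weakSet (hu n) ((hlt n).trans_le hqM)
      simp only [hv]
      have hsub : ∀ n, weakSet M (u n) ⊆ strictSet M q := fun n =>
        weakSet_subset_strictSet (hu n) (hlt n)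
      constructor <;> refine hausdorffTendsto_of_agree fun m => ?_ <;>
        obtain ⟨p, hp, h⟩ := exists_base_strictSet_agree hq hqM m <;>
        filter_upwards [hlim.eventually_const_lt hp] with n hn
      · exact ⟨fun c hc => ⟨c, hsub n (strictSet_subset_weakSet _ hc), fun _ _ => rfl⟩,
          h (u n) hn (hlt n)⟩
      · refine ⟨fun c hc => ⟨c, hsub n hc, fun _ _ => rfl⟩, fun d hd => ?_⟩
        obtain ⟨c, hc, hcd⟩ := h (u n) hn (hlt n) d hd
        exact ⟨c, strictSet_subset_weakSet _ hc, hcd⟩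
    -- Eventually `u n > M + 1` as well: all sequences are unique expansions, and the sets `vSeqs`
    -- contain every prefix.
    · rw [strictSet_eq_univ hq hqM]
      constructor <;> refine hausdorffTendsto_of_agree fun m => ?_ <;>
        filter_upwards [hlim.eventually_const_lt hqM] with n hn
      · rw [strictSet_eq_univ (hu n) hn]
        exact ⟨fun c _ => ⟨c, trivial, fun _ _ => rfl⟩, fun c _ => ⟨c, trivial, fun _ _ => rfl⟩⟩
      · exact ⟨fun c _ => ⟨c, trivial, fun _ _ => rfl⟩,
          fun d _ => exists_mem_vSeqs_agree hM (hu n) hn.le d m⟩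
  · intro hgt
    rcases lt_or_ge q (M + 1) with hqM | hqM
    · rw [vSeqs_eq_weakSet hq hqM]
      have hsub : ∀ n, weakSet M q ⊆ strictSet M (u n) := fun n =>
        weakSet_subset_strictSet hq (hgt n)
      constructor <;> refine hausdorffTendsto_of_agree fun m => ?_ <;>
        obtain ⟨p, hp, h⟩ := exists_base_weakSet_agree (M := M) hq m <;>
        filter_upwards [hlim.eventually_lt_const hp, hlim.eventually_lt_const hqM] with n hn hnM
      · exact ⟨fun c hc => h (u n) (hgt n) hn c (strictSet_subset_weakSet _ hc),
          fun d hd => ⟨d, hsub n hd, fun _ _ => rfl⟩⟩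
      · rw [vSeqs_eq_weakSet (hu n) hnM]
        exact ⟨h (u n) (hgt n) hn,
          fun d hd => ⟨d, strictSet_subset_weakSet _ (hsub n hd), fun _ _ => rfl⟩⟩
    -- The boundary base `q = M + 1` belongs here: all `u n` exceed `M + 1`, and `vSeqs M q` already
    -- contains every prefix.
    · constructor <;> refine hausdorffTendsto_of_agree fun m => Eventually.of_forall fun n => ?_
      · rw [strictSet_eq_univ (hu n) (hqM.trans_lt (hgt n))]
        exact ⟨fun c _ => exists_mem_vSeqs_agree hM hq hqM c m,
          fun d _ => ⟨d, trivial, fun _ _ => rfl⟩⟩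
      · exact ⟨fun c _ => exists_mem_vSeqs_agree hM hq hqM c m,
          fun d _ => exists_mem_vSeqs_agree hM (hu n) (hqM.trans (hgt n).le) d m⟩
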